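/- Let $(d_n)_{n\ge 1}$ be a sequence of real numbers with $0\le d_n\le n$ such that $$\lim_{n\to\infty} d_n=+\infty \qquad\text{and}\qquad \lim_{n\to\infty}\frac{\log d_n}{\log n}=0 .$$ For every $n\ge 1$ let $A_n$ be a random $n\times n$ matrix whose $n^2$ entries are independent Bernoulli random variables with parameter $d_n/n$ (that is, equal to $1$ with probability $d_n/n$ and to $0$ otherwise). Let $(N_k)_{k\ge1}$ be a family of independent standard real Gaussian random variables. Then for every integer $K\ge 1$ the random vector $$\left(\frac{\mathrm{tr}(A_n)}{\sqrt{d_n}}-\sqrt{d_n},\ \frac{\mathrm{tr}(A_n^2)}{\sqrt{d_n}^{\,2}}-\sqrt{d_n}^{\,2},\ \dots,\ \frac{\mathrm{tr}(A_n^K)}{\sqrt{d_n}^{\,K}}-\sqrt{d_n}^{\,K}\right)$$ converges in law, as $n\to\infty$, to the random vector $$\left(\sqrt{k}\,N_k+\mathbf 1_{\{k\text{ is even}\}}\right)_{1\le k\le K}=\left(N_1,\ \sqrt2\,N_2+1,\ \dots,\ \sqrt K\,N_K+\mathbf 1_{\{K\text{ is even}\}}\right).$$ -/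

import Mathlib

open MeasureTheory ProbabilityTheory Filter
open scoped Topology

/-! Write p = d/n and q = √d. The trace of the k-th power counts closed walks of length k all of
whose edges are present. If every visited vertex has only one outgoing edge in the walk, the walk
winds around a simple cycle whose length l divides k (`sum_isFunctionalWalk`). Otherwise it has more
edges than vertices, and such walks have total mean at most p(np+k)^k (`integral_excessCount_le`).
The growth hypothesis gives d^m/n → 0 for every m (`tendsto_pow_div_natCast_of_log`), so these walks
are negligible. Up to this error, tr(A^k) is the sum over l ∣ k of the number C_l of injective
closed walks of length l.

C_l has mean close to d^l, and since each cycle is counted once for each of its l rotations, its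
variance is close to l·d^l. After division by d^(k/2), only l = k contributes fluctuations, of
variance k. Its mean cancels the centering, while l = k/2, when k is even, leaves the constant 1 and
smaller divisors leave nothing (`tendsto_traceShift`).

Joint normality comes from a Stein-type argument for the characteristic function φ of a combination
W = ∑ c_α (1_α - p^|α|) over cycles α (`norm_edgeCharFun_one_sub_le`). Conditioning on the presence
of α amounts to adding its edges, which shifts W by the weight h_α of the rotations of α, up to a
small error. Hence φ'(s) ≈ -s v φ(s) with v = ∑ c_α p^|α| h_α, and φ(1) ≈ exp(-v/2). The error from
cycles that overlap α partially is small because such a cycle needs at least one more new edge than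
new vertices (`card_sdiff_lt_card_walkEdges_sdiff`). Lévy's continuity theorem then gives
convergence in law. -/

/-- The set of oriented edges of a closed walk of length `k + 1`. -/
def walkEdges {V : Type*} [DecidableEq V] {k : ℕ} (w : ZMod (k + 1) → V) : Finset (V × V) :=
  Finset.univ.image fun i => (w i, w (i + 1))

/-- A closed walk is functional if its next position is determined by its current position. -/
def IsFunctionalWalk {V : Type*} {k : ℕ} (w : ZMod (k + 1) → V) : Prop :=
  ∀ i j, w i = w j → w (i + 1) = w (j + 1)

/-! ### Traces of matrix powers as sums over closed walks -/

section Trace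

/-- The two tuples list the sources and the targets of the successive steps of a path; this form
lets the induction peel off the first step. -/
theorem Matrix.pow_succ_apply_eq_sum {V R : Type*} [Fintype V] [DecidableEq V] [CommSemiring R]
    (B : Matrix V V R) (k : ℕ) (x y : V) :
    (B ^ (k + 1)) x y = ∑ u : Fin k → V, ∏ i : Fin (k + 1),
      B ((Fin.cons x u : Fin (k + 1) → V) i) ((Fin.snoc u y : Fin (k + 1) → V) i) := by
  induction k generalizing x with
  | zero => simp [Fin.snoc]
  | succ k ih =>
    rw [_root_.pow_succ' B (k + 1), Matrix.mul_apply,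
      ← (Fin.consEquiv (fun _ : Fin (k + 1) => V)).sum_comp, Fintype.sum_prod_type]
    refine Finset.sum_congr rfl fun z _ => ?_
    rw [ih, Finset.mul_sum]
    refine Finset.sum_congr rfl fun u _ => ?_
    rw [Fin.prod_univ_succ (n := k + 1)]
    have hc : (Fin.consEquiv fun _ : Fin (k + 1) => V) (z, u) = Fin.cons z u := rfl
    simp only [hc, Fin.cons_zero, Fin.cons_succ, ← Fin.cons_snoc_eq_snoc_cons]

theorem Matrix.trace_pow_succ_eq_sum {V R : Type*} [Fintype V] [DecidableEq V] [CommSemiring R]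
    (B : Matrix V V R) (k : ℕ) :
    (B ^ (k + 1)).trace = ∑ w : ZMod (k + 1) → V, ∏ i, B (w i) (w (i + 1)) := by
  -- `ZMod (k + 1)` unfolds to `Fin (k + 1)`, and its cyclic successor closes the path.
  change _ = ∑ w : Fin (k + 1) → V, ∏ i, B (w i) (w (i + 1))
  rw [← (Fin.consEquiv (fun _ : Fin (k + 1) => V)).sum_comp, Fintype.sum_prod_type]
  simp only [Matrix.trace, Matrix.diag, Matrix.pow_succ_apply_eq_sum]
  refine Finset.sum_congr rfl fun x _ => Finset.sum_congr rfl fun u _ =>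
    Finset.prod_congr rfl fun i _ => ?_
  simp [Fin.consEquiv, Fin.snoc_eq_cons_rotate]

end Trace

/-! ### Edge and vertex counts of closed walks -/

section Walks

variable {V : Type*} [DecidableEq V]

theorem mem_walkEdges {k : ℕ} {w : ZMod (k + 1) → V} {e : V × V} :
    e ∈ walkEdges w ↔ ∃ i, (w i, w (i + 1)) = e := by
  simp [walkEdges]

theorem image_fst_walkEdges {k : ℕ} (w : ZMod (k + 1) → V) :
    (walkEdges w).image Prod.fst = Finset.univ.image w := by
  ext v
  simp [walkEdges]

theorem card_walkEdges_of_injective {k : ℕ} {w : ZMod (k + 1) → V} (hw : Function.Injective w) :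
    (walkEdges w).card = k + 1 := by
  rw [walkEdges, Finset.card_image_of_injective, Finset.card_univ, ZMod.card]
  intro i j h
  exact hw (Prod.ext_iff.1 h).1

/-- Taking sources maps the edges onto the visited vertices. Equal cardinalities would make this map
injective, which is exactly functionality. -/
theorem card_image_lt_card_walkEdges {k : ℕ} {w : ZMod (k + 1) → V} (hw : ¬ IsFunctionalWalk w) :
    (Finset.univ.image w).card + 1 ≤ (walkEdges w).card := by
  rw [← image_fst_walkEdges, Nat.add_one_le_iff]
  refine Finset.card_image_le.lt_of_ne fun hcard => ?_
  have h := Finset.card_image_iff.1 hcard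
  refine hw fun i j hij => ?_
  have := h (mem_walkEdges.2 ⟨i, rfl⟩) (mem_walkEdges.2 ⟨j, rfl⟩) hij
  exact (Prod.ext_iff.1 this).2

/-- Every new vertex is the source of a new edge. Since `β` shares an edge with `α` but is not
contained in it, `β` must also leave `α` somewhere, and this gives one further new edge, whose
source is an old vertex. -/
theorem card_sdiff_lt_card_walkEdges_sdiff {a b : ℕ} {α : ZMod (a + 1) → V} {β : ZMod (b + 1) → V}
    (hmeet : ¬ Disjoint (walkEdges β) (walkEdges α)) (hne : ¬ walkEdges β ⊆ walkEdges α) :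
    (Finset.univ.image β \ Finset.univ.image α).card + 1 ≤ (walkEdges β \ walkEdges α).card := by
  have hout : ∃ i, β i ∈ Finset.univ.image α ∧ (β i, β (i + 1)) ∉ walkEdges α := by
    by_contra! hcon
    obtain ⟨e, he, he'⟩ := Finset.not_disjoint_iff.1 hmeet
    obtain ⟨i₀, rfl⟩ := mem_walkEdges.1 he
    have hstay : ∀ m : ℕ, β (i₀ + m) ∈ Finset.univ.image α := by
      intro m
      induction m with
      | zero =>
        obtain ⟨j, hj⟩ := mem_walkEdges.1 he'
        simp only [Nat.cast_zero, add_zero, Finset.mem_image, Finset.mem_univ, true_and]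
        exact ⟨j, (Prod.ext_iff.1 hj).1⟩
      | succ m ih =>
        obtain ⟨j, hj⟩ := mem_walkEdges.1 (hcon _ ih)
        simp only [Finset.mem_image, Finset.mem_univ, true_and]
        refine ⟨j + 1, (Prod.ext_iff.1 hj).2.trans ?_⟩
        push_cast
        rw [add_assoc]
    refine hne fun e he => ?_
    obtain ⟨i, rfl⟩ := mem_walkEdges.1 he
    refine hcon i ?_
    have := hstay (i - i₀).val
    rwa [ZMod.natCast_zmod_val, add_sub_cancel] at this
  obtain ⟨i₁, hi₁, he₁⟩ := hout
  have hsub : insert (β i₁) (Finset.univ.image β \ Finset.univ.image α) ⊆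
      (walkEdges β \ walkEdges α).image Prod.fst := by
    intro v hv
    rcases Finset.mem_insert.1 hv with rfl | hv
    · exact Finset.mem_image.2 ⟨_, Finset.mem_sdiff.2 ⟨mem_walkEdges.2 ⟨i₁, rfl⟩, he₁⟩, rfl⟩
    · obtain ⟨hvβ, hvα⟩ := Finset.mem_sdiff.1 hv
      obtain ⟨i, -, rfl⟩ := Finset.mem_image.1 hvβ
      refine Finset.mem_image.2 ⟨_, Finset.mem_sdiff.2 ⟨mem_walkEdges.2 ⟨i, rfl⟩, fun h => hvα ?_⟩, rfl⟩
      obtain ⟨j, hj⟩ := mem_walkEdges.1 h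
      exact Finset.mem_image.2 ⟨j, Finset.mem_univ _, (Prod.ext_iff.1 hj).1⟩
  have hcard := (Finset.card_le_card hsub).trans Finset.card_image_le
  rwa [Finset.card_insert_of_notMem (fun h => (Finset.mem_sdiff.1 h).2 hi₁)] at hcard

/-- A vertex of an injective walk has a single outgoing edge, so `β` is forced once its starting
point is known. Time is a natural number because the two lengths may differ. -/
theorem exists_shift_of_walkEdges_subset {a b : ℕ} {α : ZMod (a + 1) → V} {β : ZMod (b + 1) → V}
    (hα : Function.Injective α) (h : walkEdges β ⊆ walkEdges α) :
    ∃ r, ∀ m : ℕ, β m = α (r + m) := by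
  obtain ⟨r, hr⟩ := mem_walkEdges.1 (h (mem_walkEdges.2 ⟨0, rfl⟩))
  refine ⟨r, fun m => ?_⟩
  induction m with
  | zero => simpa using (Prod.ext_iff.1 hr).1.symm
  | succ m ih =>
    obtain ⟨j, hj⟩ := mem_walkEdges.1 (h (mem_walkEdges.2 ⟨(m : ZMod (b + 1)), rfl⟩))
    obtain ⟨h1, h2⟩ := Prod.ext_iff.1 hj
    have : j = r + m := hα (h1.trans ih)
    subst this
    push_cast
    rw [← add_assoc]
    exact h2.symm

theorem walkEdges_eq_of_subset {a b : ℕ} {α : ZMod (a + 1) → V} {β : ZMod (b + 1) → V}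
    (hα : Function.Injective α) (h : walkEdges β ⊆ walkEdges α) : walkEdges β = walkEdges α := by
  refine h.antisymm fun e he => ?_
  obtain ⟨r, hr⟩ := exists_shift_of_walkEdges_subset hα h
  obtain ⟨i, rfl⟩ := mem_walkEdges.1 he
  refine mem_walkEdges.2 ⟨((i - r).val : ZMod (b + 1)), ?_⟩
  have h2 := hr ((i - r).val + 1)
  push_cast at h2
  rw [hr, h2, ← add_assoc, ZMod.natCast_zmod_val, add_sub_cancel]

theorem walkEdges_shift {k : ℕ} (w : ZMod (k + 1) → V) (r : ZMod (k + 1)) :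
    walkEdges (fun i => w (r + i)) = walkEdges w := by
  ext e
  simp only [mem_walkEdges]
  constructor
  · rintro ⟨i, rfl⟩
    exact ⟨r + i, by rw [add_assoc]⟩
  · rintro ⟨i, rfl⟩
    exact ⟨i - r, by rw [add_sub_cancel, ← add_assoc, add_sub_cancel]⟩

/-- Up to rotation, an injective closed walk is determined by its set of edges. -/
theorem walkEdges_eq_iff_exists_shift {k : ℕ} {α β : ZMod (k + 1) → V}
    (hα : Function.Injective α) : walkEdges β = walkEdges α ↔ ∃ r, β = fun i => α (r + i) := by
  constructor
  · intro h
    obtain ⟨r, hr⟩ := exists_shift_of_walkEdges_subset hα h.subset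
    refine ⟨r, funext fun i => ?_⟩
    have := hr i.val
    rwa [ZMod.natCast_zmod_val] at this
  · rintro ⟨r, rfl⟩
    exact walkEdges_shift α r

/-- The rotations of an injective walk are pairwise distinct. This count is the source of the factor
k in the limiting variance. -/
theorem card_filter_walkEdges_eq [Fintype V] {k : ℕ} {α : ZMod (k + 1) → V}
    (hα : Function.Injective α) :
    (Finset.univ.filter fun β : ZMod (k + 1) → V =>
      Function.Injective β ∧ walkEdges β = walkEdges α).card = k + 1 := by
  have : (Finset.univ.filter fun β : ZMod (k + 1) → V =>
      Function.Injective β ∧ walkEdges β = walkEdges α) =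
      Finset.univ.image fun r i => α (r + i) := by
    ext β
    simp only [Finset.mem_filter, Finset.mem_univ, true_and, Finset.mem_image,
      walkEdges_eq_iff_exists_shift hα]
    constructor
    · rintro ⟨-, r, rfl⟩
      exact ⟨r, rfl⟩
    · rintro ⟨r, rfl⟩
      exact ⟨hα.comp (add_right_injective r), r, rfl⟩
  rw [this, Finset.card_image_of_injective, Finset.card_univ, ZMod.card]
  intro r s h
  have := congrFun h 0
  simpa using hα this

end Walks

/-! ### Functional walks are windings of simple cycles -/

section Functional

variable {V : Type*}

theorem iterate_shift_apply {k : ℕ} (w : ZMod (k + 1) → V) (m : ℕ) :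
    (fun (u : ZMod (k + 1) → V) i => u (i + 1))^[m] w = fun i => w (i + m) := by
  induction m with
  | zero => simp
  | succ m ih =>
    rw [Function.iterate_succ_apply', ih]
    funext i
    push_cast
    rw [add_assoc, add_comm (1 : ZMod (k + 1))]

theorem IsFunctionalWalk.eq_add {k : ℕ} {w : ZMod (k + 1) → V} (hw : IsFunctionalWalk w)
    {i j : ZMod (k + 1)} (h : w i = w j) (m : ℕ) : w (i + m) = w (j + m) := by
  induction m with
  | zero => simpa using h
  | succ m ih =>
    push_cast
    rw [← add_assoc, ← add_assoc]
    exact hw _ _ ih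

theorem castHom_surjective_of_dvd {k l : ℕ} (h : l + 1 ∣ k + 1) :
    Function.Surjective (ZMod.castHom h (ZMod (l + 1))) :=
  ZMod.castHom_surjective h

/-- The cycle length is the minimal period of the walk under the shift. If a functional walk takes
the same value at two times, the walks shifted by these times agree, so within one period the times
coincide. -/
theorem IsFunctionalWalk.exists_eq_comp_castHom {k : ℕ} {w : ZMod (k + 1) → V}
    (hw : IsFunctionalWalk w) :
    ∃ (l : ℕ) (h : l + 1 ∣ k + 1) (u : ZMod (l + 1) → V),
      Function.Injective u ∧ w = u ∘ ZMod.castHom h (ZMod (l + 1)) := by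
  set T : (ZMod (k + 1) → V) → (ZMod (k + 1) → V) := fun u i => u (i + 1) with hT
  have hiter : ∀ m : ℕ, T^[m] w = fun i => w (i + m) := iterate_shift_apply w
  have hper : Function.IsPeriodicPt T (k + 1) w := by
    rw [Function.IsPeriodicPt, Function.IsFixedPt, hiter]
    funext i
    rw [ZMod.natCast_self, add_zero]
  have hpos : 0 < Function.minimalPeriod T w := hper.minimalPeriod_pos k.succ_pos
  obtain ⟨l, hl⟩ := Nat.exists_eq_add_of_lt hpos
  rw [zero_add] at hl
  have hdvd : l + 1 ∣ k + 1 := hl ▸ hper.minimalPeriod_dvd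
  refine ⟨l, hdvd, fun a => w (a.val : ZMod (k + 1)), fun a b hab => ?_, funext fun i => ?_⟩
  · apply ZMod.val_injective
    refine Function.iterate_injOn_Iio_minimalPeriod (f := T) (x := w) ?_ ?_ ?_
    · rw [Set.mem_Iio, hl]; exact ZMod.val_lt a
    · rw [Set.mem_Iio, hl]; exact ZMod.val_lt b
    · simp only [hiter]
      funext i
      have := hw.eq_add hab i.val
      rw [ZMod.natCast_zmod_val] at this
      rw [add_comm, this, add_comm]
  · have h1 := Function.iterate_mod_minimalPeriod_eq (f := T) (x := w) (n := i.val)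
    rw [hl, hiter, hiter] at h1
    have h2 := congrFun h1 0
    simp only [zero_add, ZMod.natCast_zmod_val] at h2
    rw [← h2, Function.comp_apply]
    congr 2

theorem walkEdges_comp_castHom [DecidableEq V] {k l : ℕ} (h : l + 1 ∣ k + 1)
    (u : ZMod (l + 1) → V) :
    walkEdges (u ∘ ZMod.castHom h (ZMod (l + 1))) = walkEdges u := by
  ext e
  simp only [mem_walkEdges, Function.comp_apply, map_add, map_one]
  exact ⟨fun ⟨i, hi⟩ => ⟨_, hi⟩, fun ⟨i, hi⟩ => by
    obtain ⟨j, rfl⟩ := castHom_surjective_of_dvd h i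
    exact ⟨j, hi⟩⟩

/-- A functional closed walk winds around a cycle a whole number of times. -/
theorem sum_isFunctionalWalk {M : Type*} [AddCommMonoid M] [Fintype V] [DecidableEq V]
    (f : Finset (V × V) → M) {K k : ℕ} (hk : k < K) [DecidablePred (IsFunctionalWalk (V := V) (k := k))] :
    ∑ w : ZMod (k + 1) → V with IsFunctionalWalk w, f (walkEdges w) =
      ∑ l : Fin K with l.val + 1 ∣ k + 1,
        ∑ u : ZMod (l.val + 1) → V with Function.Injective u, f (walkEdges u) := by
  rw [Finset.sum_sigma']
  symm
  refine Finset.sum_bij (fun x hx => x.2 ∘ ZMod.castHom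
    (Finset.mem_filter.1 (Finset.mem_sigma.1 hx).1).2 (ZMod (x.1.val + 1))) ?_ ?_ ?_ ?_
  · rintro ⟨l, u⟩ hx
    obtain ⟨h1, h2⟩ := Finset.mem_sigma.1 hx
    have hu : Function.Injective u := (Finset.mem_filter.1 h2).2
    simp only [Finset.mem_filter, Finset.mem_univ, true_and]
    intro i j hij
    simp only [Function.comp_apply, map_add, map_one] at hij ⊢
    rw [hu hij]
  · rintro ⟨l, u⟩ hx ⟨l', u'⟩ hx' h
    have hu : Function.Injective u := (Finset.mem_filter.1 (Finset.mem_sigma.1 hx).2).2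
    have hu' : Function.Injective u' := (Finset.mem_filter.1 (Finset.mem_sigma.1 hx').2).2
    have hd := (Finset.mem_filter.1 (Finset.mem_sigma.1 hx).1).2
    have hd' := (Finset.mem_filter.1 (Finset.mem_sigma.1 hx').1).2
    simp only at h hd hd'
    -- The number of distinct edges recovers the length of the underlying cycle.
    have hE := congrArg walkEdges h
    rw [walkEdges_comp_castHom, walkEdges_comp_castHom] at hE
    have hc := congrArg Finset.card hE
    rw [card_walkEdges_of_injective hu, card_walkEdges_of_injective hu', Nat.add_right_cancel_iff] at hc
    obtain rfl : l = l' := Fin.ext hc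
    obtain rfl : u = u' := (castHom_surjective_of_dvd hd).injective_comp_right h
    rfl
  · intro w hw
    obtain ⟨l, h, u, hu, rfl⟩ := (Finset.mem_filter.1 hw).2.exists_eq_comp_castHom
    refine ⟨⟨⟨l, ?_⟩, u⟩, ?_, rfl⟩
    · have := Nat.le_of_dvd k.succ_pos h
      omega
    · simp [hu, h]
  · rintro ⟨l, u⟩ hx
    exact congrArg f (walkEdges_comp_castHom _ u).symm

end Functional

/-! ### Weighted count of vertex sequences -/

section Counting

/-- Choose the vertices one at a time: a fresh vertex has at most |V| choices and costs a factor
`p`, while a vertex already seen or in `S` has at most |S| + k choices and costs nothing. -/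
theorem sum_pow_card_image_sdiff_le {V : Type*} [Fintype V] [DecidableEq V] {p : ℝ} (hp : 0 ≤ p)
    (S : Finset V) (k : ℕ) :
    ∑ w : Fin k → V, p ^ (Finset.univ.image w \ S).card ≤
      (Fintype.card V * p + S.card + k) ^ k := by
  induction k with
  | zero => simp
  | succ k ih =>
    have hbase : (0 : ℝ) ≤ Fintype.card V * p + S.card + k := by positivity
    have key : ∀ w : Fin k → V,
        ∑ x, p ^ (Finset.univ.image (Fin.cons x w : Fin (k + 1) → V) \ S).card ≤
          p ^ (Finset.univ.image w \ S).card * (Fintype.card V * p + S.card + k) := by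
      intro w
      have hx : ∀ x, p ^ (Finset.univ.image (Fin.cons x w : Fin (k + 1) → V) \ S).card ≤
          p ^ (Finset.univ.image w \ S).card *
            (p + if x ∈ S ∪ Finset.univ.image w then 1 else 0) := by
        intro x
        have himg : Finset.univ.image (Fin.cons x w : Fin (k + 1) → V) =
            insert x (Finset.univ.image w) := by
          ext v
          simp [Fin.exists_fin_succ, eq_comm]
        rw [himg]
        split_ifs with h
        · have : insert x (Finset.univ.image w) \ S = Finset.univ.image w \ S := by
            ext v
            simp only [Finset.mem_union] at h
            simp only [Finset.mem_sdiff, Finset.mem_insert]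
            constructor
            · rintro ⟨rfl | h1, h2⟩
              · exact ⟨h.resolve_left h2, h2⟩
              · exact ⟨h1, h2⟩
            · exact fun h => ⟨Or.inr h.1, h.2⟩
          rw [this]
          exact le_mul_of_one_le_right (by positivity) (by linarith)
        · simp only [Finset.mem_union, not_or] at h
          rw [Finset.insert_sdiff_of_notMem _ h.1,
            Finset.card_insert_of_notMem (fun h' => h.2 (Finset.mem_sdiff.1 h').1),
            pow_succ, add_zero]
      refine (Finset.sum_le_sum fun x _ => hx x).trans ?_
      rw [← Finset.mul_sum]
      refine mul_le_mul_of_nonneg_left ?_ (by positivity)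
      rw [Finset.sum_add_distrib, Finset.sum_const, Finset.card_univ, nsmul_eq_mul,
        Finset.sum_boole, Finset.filter_mem_eq_inter, Finset.univ_inter, add_assoc]
      have h1 : (S ∪ Finset.univ.image w).card ≤ S.card + k := by
        refine (Finset.card_union_le _ _).trans (Nat.add_le_add_left ?_ _)
        exact Finset.card_image_le.trans (by simp)
      have h2 : ((S ∪ Finset.univ.image w).card : ℝ) ≤ S.card + k := by exact_mod_cast h1
      linarith
    rw [← (Fin.consEquiv (fun _ : Fin (k + 1) => V)).sum_comp, Fintype.sum_prod_type,
      Finset.sum_comm]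
    calc _ ≤ ∑ w : Fin k → V, p ^ (Finset.univ.image w \ S).card *
          (Fintype.card V * p + S.card + k) := Finset.sum_le_sum fun w _ => key w
      _ ≤ (Fintype.card V * p + S.card + k) ^ k * (Fintype.card V * p + S.card + k) := by
        rw [← Finset.sum_mul]
        exact mul_le_mul_of_nonneg_right ih hbase
      _ ≤ _ := by
        rw [← pow_succ]
        refine pow_le_pow_left₀ hbase ?_ _
        push_cast
        linarith

theorem sum_pow_card_walk_image_sdiff_le {V : Type*} [Fintype V] [DecidableEq V] {p : ℝ}
    (hp : 0 ≤ p) (S : Finset V) (k : ℕ) :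
    ∑ w : ZMod (k + 1) → V, p ^ (Finset.univ.image w \ S).card ≤
      (Fintype.card V * p + S.card + (k + 1 : ℕ)) ^ (k + 1) :=
  sum_pow_card_image_sdiff_le hp S (k + 1)

end Counting

/-! ### Independent edges and conditioning on their presence -/

section RandomEdges

variable {E : Type*}

/-- Indicator that all edges of `T` are present in the configuration `x`. -/
def edgeInd (T : Finset E) (x : E → Bool) : ℝ := if ∀ e ∈ T, x e = true then 1 else 0

theorem edgeInd_nonneg (T : Finset E) (x : E → Bool) : 0 ≤ edgeInd T x := by
  unfold edgeInd; split_ifs <;> simp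

theorem edgeInd_anti {S T : Finset E} (h : S ⊆ T) (x : E → Bool) : edgeInd T x ≤ edgeInd S x := by
  unfold edgeInd
  split_ifs with h1 h2 h2
  · exact le_rfl
  · exact absurd (fun e he => h1 e (h he)) h2
  · exact zero_le_one
  · exact le_rfl

theorem edgeInd_eq_prod (T : Finset E) (x : E → Bool) :
    edgeInd T x = ∏ e ∈ T, if x e = true then 1 else 0 := by
  unfold edgeInd
  split_ifs with h
  · exact (Finset.prod_eq_one fun e he => by rw [if_pos (h e he)]).symm
  · push Not at h
    obtain ⟨e, he, hx⟩ := h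
    exact (Finset.prod_eq_zero he (if_neg hx)).symm

/-- Law of independent Bernoulli edges. -/
noncomputable def edgeMeasure (E : Type*) [Fintype E] (p : unitInterval) : Measure (E → Bool) :=
  Measure.pi fun _ => bernoulliMeasure true false p

instance [Fintype E] (p : unitInterval) : IsProbabilityMeasure (edgeMeasure E p) := by
  unfold edgeMeasure; infer_instance

theorem integrable_edgeMeasure [Fintype E] {F : Type*} [NormedAddCommGroup F] (p : unitInterval)
    (G : (E → Bool) → F) : Integrable G (edgeMeasure E p) := Integrable.of_finite

variable [DecidableEq E]

/-- The configuration obtained from `x` by adding all edges of `T`. -/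
def addEdges (T : Finset E) (x : E → Bool) : E → Bool := fun e => if e ∈ T then true else x e

theorem edgeInd_addEdges (S T : Finset E) (x : E → Bool) :
    edgeInd S (addEdges T x) = edgeInd (S \ T) x := by
  unfold edgeInd addEdges
  congr 1
  simp only [Finset.mem_sdiff, eq_iff_iff]
  constructor
  · rintro h e ⟨h1, h2⟩
    simpa [h2] using h e h1
  · intro h e he
    split_ifs with h1
    · rfl
    · exact h e ⟨he, h1⟩

variable [Fintype E]

theorem integral_edgeInd (p : unitInterval) (T : Finset E) :
    ∫ x, edgeInd T x ∂edgeMeasure E p = (p : ℝ) ^ T.card := by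
  have h : ∀ x : E → Bool, edgeInd T x =
      ∏ e, (if e ∈ T then (if x e = true then (1 : ℝ) else 0) else 1) := by
    intro x
    rw [edgeInd_eq_prod, Finset.prod_ite_mem, Finset.univ_inter]
  simp_rw [h]
  rw [edgeMeasure, integral_fintype_prod_eq_prod
    (f := fun (e : E) (b : Bool) => if e ∈ T then (if b = true then (1 : ℝ) else 0) else 1)]
  simp_rw [integral_bernoulliMeasure]
  calc _ = ∏ e, (if e ∈ T then (p : ℝ) else 1) :=
        Finset.prod_congr rfl fun e _ => by by_cases h : e ∈ T <;> simp [h]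
    _ = _ := by rw [Finset.prod_ite_mem, Finset.univ_inter, Finset.prod_const]

/-- Conditioning on the presence of the edges of `T` amounts to adding them. -/
theorem integral_edgeInd_mul (p : unitInterval) (T : Finset E) (G : (E → Bool) → ℂ) :
    ∫ x, (edgeInd T x : ℂ) * G x ∂edgeMeasure E p =
      (p : ℂ) ^ T.card * ∫ x, G (addEdges T x) ∂edgeMeasure E p := by
  have h1 : ∀ x, (edgeInd T x : ℂ) * G x = (edgeInd T x : ℂ) * G (addEdges T x) := by
    intro x
    by_cases h : ∀ e ∈ T, x e = true
    · have : addEdges T x = x := by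
        funext e
        unfold addEdges
        split_ifs with he
        · exact (h e he).symm
        · rfl
      rw [this]
    · simp [edgeInd, h]
  simp_rw [h1]
  -- After the substitution, the second factor depends only on the edges outside `T`, hence is
  -- independent of the indicator.
  have hind : iIndepFun (fun (e : E) (x : E → Bool) => x e) (edgeMeasure E p) :=
    iIndepFun_pi (X := fun _ => id) fun _ => aemeasurable_id
  have h2 := hind.indepFun_finset T Tᶜ disjoint_compl_right fun e => measurable_pi_apply e
  let f : (T → Bool) → ℂ := fun y => ((if ∀ e, y e = true then (1 : ℝ) else 0 : ℝ) : ℂ)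
  let g : ((Tᶜ : Finset E) → Bool) → ℂ := fun y =>
    G fun e => if h : e ∈ T then true else y ⟨e, Finset.mem_compl.2 h⟩
  have h3 := (h2.comp (φ := f) (ψ := g) .of_discrete .of_discrete).integral_fun_mul_eq_mul_integral
    (Measurable.of_discrete.aestronglyMeasurable) (Measurable.of_discrete.aestronglyMeasurable)
  have hf : ∀ x : E → Bool, (edgeInd T x : ℂ) = (f ∘ fun a (i : T) => a i) x := by
    intro x
    simp [f, edgeInd]
  have hg : ∀ x : E → Bool, G (addEdges T x) = (g ∘ fun a (i : (Tᶜ : Finset E)) => a i) x := by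
    intro x
    simp only [g, Function.comp_apply]
    congr 1
  rw [← Complex.ofReal_pow, ← integral_edgeInd p T, ← integral_complex_ofReal]
  simp_rw [hf, hg]
  exact h3

end RandomEdges

/-! ### Stein-type estimate for the characteristic function -/

section CharacteristicFunction

/-- Replace `y` by `z` using that the exponential is 1-Lipschitz on the imaginary axis, then expand
to second order. The constant 2 covers |z| ≥ 1, where the crude bound 2|z| suffices. -/
theorem norm_exp_ofReal_mul_I_sub_le (y z : ℝ) :
    ‖Complex.exp (y * Complex.I) - 1 - z * Complex.I‖ ≤ |y - z| + 2 * z ^ 2 := by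
  have h0 : ∀ x : ℝ, ‖Complex.exp (x * Complex.I) - 1‖ ≤ |x| := fun x => by
    rw [mul_comm]; exact Real.norm_exp_I_mul_ofReal_sub_one_le
  have h1 : ‖Complex.exp (y * Complex.I) - Complex.exp (z * Complex.I)‖ ≤ |y - z| := by
    have : Complex.exp (y * Complex.I) - Complex.exp (z * Complex.I) =
        Complex.exp (z * Complex.I) * (Complex.exp (((y - z : ℝ) : ℂ) * Complex.I) - 1) := by
      rw [mul_sub, ← Complex.exp_add, mul_one]
      congr 2
      push_cast
      ring
    rw [this, norm_mul, Complex.norm_exp_ofReal_mul_I, one_mul]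
    exact h0 _
  have hz : ‖(z : ℂ) * Complex.I‖ = |z| := by simp
  have h2 : ‖Complex.exp (z * Complex.I) - 1 - z * Complex.I‖ ≤ 2 * z ^ 2 := by
    rcases le_total |z| 1 with h | h
    · refine (Complex.norm_exp_sub_one_sub_id_le (by rwa [hz])).trans ?_
      rw [hz, sq_abs]
      nlinarith [sq_nonneg z]
    · refine (norm_sub_le _ _).trans ?_
      rw [hz, ← sq_abs]
      nlinarith [h0 z]
  calc _ = ‖(Complex.exp (y * Complex.I) - Complex.exp (z * Complex.I)) +
        (Complex.exp (z * Complex.I) - 1 - z * Complex.I)‖ := by congr 1; ring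
    _ ≤ _ := (norm_add_le _ _).trans (add_le_add h1 h2)

variable {E I : Type*} [DecidableEq E] [Fintype I]

/-- Linear combination of centered edge indicators. -/
def centeredSum (T : I → Finset E) (c : I → ℝ) (p : ℝ) (x : E → Bool) : ℝ :=
  ∑ α, c α * (edgeInd (T α) x - p ^ (T α).card)

/-- Total coefficient of the indices having the same edge set as `α`. -/
def classWeight (T : I → Finset E) (c : I → ℝ) (α : I) : ℝ :=
  ∑ β with T β = T α, c β

/-- Expected weight of the indices whose edge set meets that of `α` without being equal to it,
given that the edges of `α` are present. -/
def overlapWeight (T : I → Finset E) (c : I → ℝ) (p : ℝ) (α : I) : ℝ :=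
  ∑ β with T β ≠ T α ∧ ¬ Disjoint (T β) (T α), |c β| * p ^ (T β \ T α).card

/-- Adding the edges of `T α` turns on all indices with the same edge set, leaves those with
disjoint edge sets unchanged, and changes any other indicator by at most the indicator of its
missing edges. -/
theorem abs_centeredSum_addEdges_sub_le (T : I → Finset E) (c : I → ℝ) (p : ℝ) (α : I)
    (x : E → Bool) :
    |centeredSum T c p (addEdges (T α) x) - centeredSum T c p x - classWeight T c α| ≤
      |classWeight T c α| * edgeInd (T α) x +
        ∑ β with T β ≠ T α ∧ ¬ Disjoint (T β) (T α), |c β| * edgeInd (T β \ T α) x := by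
  set D : I → ℝ := fun β => c β * (edgeInd (T β \ T α) x - edgeInd (T β) x) with hD
  have h1 : centeredSum T c p (addEdges (T α) x) - centeredSum T c p x = ∑ β, D β := by
    simp only [centeredSum, ← Finset.sum_sub_distrib, edgeInd_addEdges, hD]
    exact Finset.sum_congr rfl fun β _ => by ring
  have h2 : ∑ β with T β = T α, D β = classWeight T c α * (1 - edgeInd (T α) x) := by
    rw [classWeight, Finset.sum_mul]
    refine Finset.sum_congr rfl fun β hβ => ?_
    have h : T β = T α := (Finset.mem_filter.1 hβ).2
    have h' : edgeInd (∅ : Finset E) x = 1 := by simp [edgeInd]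
    simp only [hD, h, Finset.sdiff_self, h']
  have h3 : |(∑ β with ¬ T β = T α, D β)| ≤
      ∑ β with T β ≠ T α ∧ ¬ Disjoint (T β) (T α), |c β| * edgeInd (T β \ T α) x := by
    rw [← Finset.filter_filter, Finset.sum_filter (fun β => ¬ Disjoint (T β) (T α))]
    refine le_trans (Finset.abs_sum_le_sum_abs _ _) (Finset.sum_le_sum fun β _ => ?_)
    by_cases hd : Disjoint (T β) (T α)
    · simp [hD, hd, Finset.sdiff_eq_self_of_disjoint hd]
    · rw [if_pos hd, hD, abs_mul]
      refine mul_le_mul_of_nonneg_left ?_ (abs_nonneg _)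
      rw [abs_of_nonneg (sub_nonneg.2 (edgeInd_anti Finset.sdiff_subset x))]
      exact sub_le_self _ (edgeInd_nonneg _ _)
  rw [h1, ← Finset.sum_filter_add_sum_filter_not _ (fun β => T β = T α), h2]
  calc _ = |(-(classWeight T c α * edgeInd (T α) x)) + (∑ β with ¬ T β = T α, D β)| := by
        congr 1; ring
    _ ≤ _ := by
        refine (abs_add_le _ _).trans (add_le_add ?_ h3)
        rw [abs_neg, abs_mul, abs_of_nonneg (edgeInd_nonneg _ _)]

variable [Fintype E]

/-- The characteristic function of `centeredSum` at `s`. -/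
noncomputable def edgeCharFun (T : I → Finset E) (c : I → ℝ) (p : unitInterval) (s : ℝ) : ℂ :=
  ∫ x, Complex.exp ((s * centeredSum T c p x : ℝ) * Complex.I) ∂edgeMeasure E p

/-- Approximate Stein identity: given that α is present, the exponential is on average (1 + i s h_α)
φ(s), where h_α is the class weight. The errors are the chance that α was already there, partial
overlaps, and the second-order Taylor term. -/
theorem norm_integral_edgeInd_mul_exp_sub_le (T : I → Finset E) (c : I → ℝ) (p : unitInterval)
    (α : I) (s : ℝ) :
    ‖∫ x, (edgeInd (T α) x : ℂ) * Complex.exp ((s * centeredSum T c p x : ℝ) * Complex.I)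
        ∂edgeMeasure E p - (p : ℂ) ^ (T α).card * edgeCharFun T c p s
        - (p : ℂ) ^ (T α).card * ((s * classWeight T c α : ℝ) * Complex.I) * edgeCharFun T c p s‖ ≤
      (p : ℝ) ^ (T α).card * (|s| * (|classWeight T c α| * (p : ℝ) ^ (T α).card +
        overlapWeight T c p α) + 2 * (s * classWeight T c α) ^ 2) := by
  set W := centeredSum T c (p : ℝ) with hW
  set h := classWeight T c α with hh
  rw [integral_edgeInd_mul p (T α) fun x => Complex.exp ((s * W x : ℝ) * Complex.I), edgeCharFun,
    mul_assoc, ← mul_sub, ← mul_sub, norm_mul, norm_pow, Complex.norm_real, Real.norm_eq_abs,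
    abs_of_nonneg p.2.1]
  refine mul_le_mul_of_nonneg_left ?_ (pow_nonneg p.2.1 _)
  rw [← integral_const_mul, ← integral_sub (integrable_edgeMeasure _ _) (integrable_edgeMeasure _ _),
    ← integral_sub (integrable_edgeMeasure _ _) (integrable_edgeMeasure _ _)]
  have hpt : ∀ x, ‖Complex.exp ((s * W (addEdges (T α) x) : ℝ) * Complex.I) -
      Complex.exp ((s * W x : ℝ) * Complex.I) -
      ((s * h : ℝ) * Complex.I) * Complex.exp ((s * W x : ℝ) * Complex.I)‖ ≤
      |s| * (|h| * edgeInd (T α) x + ∑ β with T β ≠ T α ∧ ¬ Disjoint (T β) (T α),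
        |c β| * edgeInd (T β \ T α) x) + 2 * (s * h) ^ 2 := by
    intro x
    have : Complex.exp ((s * W (addEdges (T α) x) : ℝ) * Complex.I) -
      Complex.exp ((s * W x : ℝ) * Complex.I) -
      ((s * h : ℝ) * Complex.I) * Complex.exp ((s * W x : ℝ) * Complex.I) =
      Complex.exp ((s * W x : ℝ) * Complex.I) *
        (Complex.exp ((s * (W (addEdges (T α) x) - W x) : ℝ) * Complex.I) - 1 -
          (s * h : ℝ) * Complex.I) := by
      rw [mul_sub, mul_sub, ← Complex.exp_add, mul_one, mul_comm (Complex.exp _) (_ * Complex.I)]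
      congr 3
      push_cast
      ring
    rw [this, norm_mul, Complex.norm_exp_ofReal_mul_I, one_mul]
    refine (norm_exp_ofReal_mul_I_sub_le _ _).trans (add_le_add ?_ le_rfl)
    rw [← mul_sub, abs_mul]
    exact mul_le_mul_of_nonneg_left (abs_centeredSum_addEdges_sub_le T c p α x) (abs_nonneg _)
  refine (norm_integral_le_integral_norm _).trans
    ((integral_mono (integrable_edgeMeasure _ _) (integrable_edgeMeasure _ _) hpt).trans_eq ?_)
  rw [integral_add (integrable_edgeMeasure _ _) (integrable_edgeMeasure _ _), integral_const_mul,
    integral_add (integrable_edgeMeasure _ _) (integrable_edgeMeasure _ _), integral_const_mul,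
    integral_edgeInd, integral_finsetSum _ fun _ _ => integrable_edgeMeasure _ _]
  simp_rw [integral_const_mul, integral_edgeInd]
  simp [overlapWeight]

/-- The configuration space is finite, so the integral is a finite sum and can be differentiated
termwise. -/
theorem hasDerivAt_edgeCharFun (T : I → Finset E) (c : I → ℝ) (p : unitInterval) (s : ℝ) :
    HasDerivAt (edgeCharFun T c p) (Complex.I * ∑ α, (c α : ℂ) *
      (∫ x, (edgeInd (T α) x : ℂ) * Complex.exp ((s * centeredSum T c p x : ℝ) * Complex.I)
        ∂edgeMeasure E p - (p : ℂ) ^ (T α).card * edgeCharFun T c p s)) s := by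
  have h1 : ∀ x, HasDerivAt
      (fun s : ℝ => Complex.exp ((s * centeredSum T c p x : ℝ) * Complex.I))
      (Complex.exp ((s * centeredSum T c p x : ℝ) * Complex.I) *
        ((centeredSum T c p x : ℝ) * Complex.I)) s := by
    intro x
    refine HasDerivAt.cexp (HasDerivAt.mul_const ?_ _)
    simpa using ((hasDerivAt_id s).mul_const (centeredSum T c (p : ℝ) x)).ofReal_comp
  have h2 : HasDerivAt (edgeCharFun T c p) (∫ x, Complex.exp ((s * centeredSum T c p x : ℝ) *
      Complex.I) * ((centeredSum T c p x : ℝ) * Complex.I) ∂edgeMeasure E p) s := by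
    have h3 : edgeCharFun T c p = fun s => ∑ x, (edgeMeasure E p).real {x} •
        Complex.exp ((s * centeredSum T c p x : ℝ) * Complex.I) := by
      funext s
      rw [edgeCharFun, integral_fintype (integrable_edgeMeasure _ _)]
    rw [h3, integral_fintype (integrable_edgeMeasure _ _)]
    exact HasDerivAt.fun_sum fun x _ => (h1 x).fun_const_smul _
  convert h2 using 1
  have h4 : ∀ x, Complex.exp ((s * centeredSum T c p x : ℝ) * Complex.I) *
      ((centeredSum T c p x : ℝ) * Complex.I) = Complex.I * ∑ α, (c α : ℂ) *
        ((edgeInd (T α) x : ℂ) * Complex.exp ((s * centeredSum T c p x : ℝ) * Complex.I) -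
          (p : ℂ) ^ (T α).card * Complex.exp ((s * centeredSum T c p x : ℝ) * Complex.I)) := by
    intro x
    have : ((centeredSum T c p x : ℝ) : ℂ) =
        ∑ α, (c α : ℂ) * ((edgeInd (T α) x : ℂ) - (p : ℂ) ^ (T α).card) := by
      simp [centeredSum]
    rw [mul_comm (Complex.exp _), mul_comm _ Complex.I, mul_assoc]
    congr 1
    generalize Complex.exp ((s * centeredSum T c p x : ℝ) * Complex.I) = e
    rw [this, Finset.sum_mul]
    exact Finset.sum_congr rfl fun α _ => by ring
  simp_rw [h4]
  rw [integral_const_mul, integral_finsetSum _ fun _ _ => integrable_edgeMeasure _ _]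
  congr 1
  refine Finset.sum_congr rfl fun α _ => ?_
  rw [integral_const_mul, integral_sub (integrable_edgeMeasure _ _) (integrable_edgeMeasure _ _),
    integral_const_mul, edgeCharFun]

/-- Quantitative central limit theorem for weakly overlapping edge indicators. -/
theorem norm_edgeCharFun_one_sub_le (T : I → Finset E) (c : I → ℝ) (p : unitInterval) {v δ : ℝ}
    (hv : v = ∑ α, c α * (p : ℝ) ^ (T α).card * classWeight T c α)
    (hδ : ∑ α, |c α| * (p : ℝ) ^ (T α).card * (|classWeight T c α| * (p : ℝ) ^ (T α).card +
        overlapWeight T c p α + 2 * classWeight T c α ^ 2) ≤ δ) :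
    ‖edgeCharFun T c p 1 - Complex.exp (-(v / 2 : ℝ))‖ ≤ δ * Real.exp |v| := by
  have hov : ∀ α, 0 ≤ overlapWeight T c p α := fun α =>
    Finset.sum_nonneg fun β _ => mul_nonneg (abs_nonneg _) (pow_nonneg p.2.1 _)
  set φ' : ℝ → ℂ := fun s => Complex.I * ∑ α, (c α : ℂ) *
      (∫ x, (edgeInd (T α) x : ℂ) * Complex.exp ((s * centeredSum T c p x : ℝ) * Complex.I)
        ∂edgeMeasure E p - (p : ℂ) ^ (T α).card * edgeCharFun T c p s) with hφ'
  have hD : ∀ s, HasDerivAt (edgeCharFun T c p) (φ' s) s := hasDerivAt_edgeCharFun T c p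
  -- The approximate Gaussian differential equation φ' = -s v φ, with error at most `δ`.
  have hbound : ∀ s ∈ Set.Ico (0 : ℝ) 1,
      ‖φ' s + (s * v : ℝ) * edgeCharFun T c p s‖ ≤ δ := by
    intro s hs
    have : φ' s + (s * v : ℝ) * edgeCharFun T c p s = Complex.I * ∑ α, (c α : ℂ) *
      (∫ x, (edgeInd (T α) x : ℂ) * Complex.exp ((s * centeredSum T c p x : ℝ) * Complex.I)
        ∂edgeMeasure E p - (p : ℂ) ^ (T α).card * edgeCharFun T c p s
        - (p : ℂ) ^ (T α).card * ((s * classWeight T c α : ℝ) * Complex.I) *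
          edgeCharFun T c p s) := by
      simp_rw [mul_sub (_ : ℂ) (_ - _) (_ * _)]
      rw [Finset.sum_sub_distrib, mul_sub, hφ', sub_eq_add_neg]
      congr 1
      rw [hv, Finset.mul_sum, ← mul_neg_one, Finset.mul_sum, Finset.sum_mul]
      push_cast
      rw [Finset.sum_mul]
      refine Finset.sum_congr rfl fun α _ => ?_
      linear_combination ((s : ℂ) * c α * p ^ (T α).card * classWeight T c α *
        edgeCharFun T c p s) * Complex.I_sq
    rw [this, norm_mul, Complex.norm_I, one_mul]
    refine (norm_sum_le _ _).trans (le_trans (Finset.sum_le_sum fun α _ => ?_) hδ)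
    rw [norm_mul, Complex.norm_real, Real.norm_eq_abs, mul_assoc |c α|]
    refine mul_le_mul_of_nonneg_left
      ((norm_integral_edgeInd_mul_exp_sub_le T c p α s).trans ?_) (abs_nonneg _)
    refine mul_le_mul_of_nonneg_left ?_ (pow_nonneg p.2.1 _)
    have h1 : 0 ≤ |classWeight T c α| * (p : ℝ) ^ (T α).card + overlapWeight T c p α :=
      add_nonneg (mul_nonneg (abs_nonneg _) (pow_nonneg p.2.1 _)) (hov α)
    rw [abs_of_nonneg hs.1, mul_pow]
    refine add_le_add (mul_le_of_le_one_left h1 hs.2.le) ?_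
    have : s ^ 2 ≤ 1 := pow_le_one₀ hs.1 hs.2.le
    nlinarith [sq_nonneg (classWeight T c α)]
  -- Integrating factor: `g` would be constant if the differential equation held exactly.
  set g : ℝ → ℂ := fun s => edgeCharFun T c p s * Complex.exp ((v / 2 * s ^ 2 : ℝ)) with hg
  have hgD : ∀ s, HasDerivAt g ((φ' s + (s * v : ℝ) * edgeCharFun T c p s) *
      Complex.exp ((v / 2 * s ^ 2 : ℝ))) s := by
    intro s
    have h1 : HasDerivAt (fun s : ℝ => v / 2 * s ^ 2) (s * v) s := by
      refine ((hasDerivAt_pow 2 s).const_mul (v / 2)).congr_deriv ?_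
      push_cast
      ring
    refine ((hD s).mul h1.ofReal_comp.cexp).congr_deriv ?_
    ring
  have hexp : ∀ r : ℝ, ‖Complex.exp (r : ℂ)‖ = Real.exp r := fun r => by
    rw [← Complex.ofReal_exp, Complex.norm_real, Real.norm_eq_abs, Real.abs_exp]
  have hδ0 : 0 ≤ δ := (norm_nonneg _).trans (hbound 0 (by simp))
  have hmv := norm_image_sub_le_of_norm_deriv_le_segment_01' (f := g) (C := δ * Real.exp (|v| / 2))
    (fun s _ => (hgD s).hasDerivWithinAt) (fun s hs => by
      rw [norm_mul, hexp]
      refine mul_le_mul (hbound s hs) (Real.exp_le_exp.2 ?_) (Real.exp_pos _).le hδ0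
      have : s ^ 2 ≤ 1 := pow_le_one₀ hs.1 hs.2.le
      nlinarith [le_abs_self v, abs_nonneg v, sq_nonneg s])
  have hg0 : g 0 = 1 := by simp [hg, edgeCharFun]
  have hfin : edgeCharFun T c p 1 - Complex.exp (-(v / 2 : ℝ)) =
      (g 1 - g 0) * Complex.exp ((-(v / 2) : ℝ)) := by
    rw [hg0, hg, sub_mul, mul_assoc, ← Complex.exp_add]
    simp
  rw [hfin, norm_mul, hexp]
  calc _ ≤ δ * Real.exp (|v| / 2) * Real.exp (|v| / 2) := by
        refine mul_le_mul hmv (Real.exp_le_exp.2 ?_) (Real.exp_pos _).le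
          (mul_nonneg hδ0 (Real.exp_pos _).le)
        linarith [neg_abs_le v]
    _ = _ := by rw [mul_assoc, ← Real.exp_add]; ring_nf

end CharacteristicFunction

/-! ### Specialisation to cycle counts -/

section Cycles

/-- Injective closed walks of length at most `K`. -/
abbrev CycleIndex (V : Type*) (K : ℕ) : Type _ :=
  Σ l : Fin K, {w : ZMod (l.val + 1) → V // Function.Injective w}

/-- The edges of the closed walk `α`. -/
def cycleEdges {V : Type*} [DecidableEq V] {K : ℕ} (α : CycleIndex V K) : Finset (V × V) :=
  walkEdges α.2.1

variable {V : Type*} [DecidableEq V] {K : ℕ}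

theorem card_cycleEdges (α : CycleIndex V K) : (cycleEdges α).card = α.1.val + 1 :=
  card_walkEdges_of_injective α.2.2

variable [Fintype V]

/-- Equal edge sets force equal lengths, so the class of a cycle consists of its rotations. -/
theorem classWeight_cycleEdges (c : Fin K → ℝ) (α : CycleIndex V K) :
    classWeight cycleEdges (fun β : CycleIndex V K => c β.1) α = (α.1.val + 1 : ℕ) * c α.1 := by
  obtain ⟨l, w, hw⟩ := α
  have h1 : ∀ β ∈ Finset.univ.filter fun β : CycleIndex V K =>
      cycleEdges β = cycleEdges ⟨l, w, hw⟩, c β.1 = c l := by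
    intro β hβ
    have h := congrArg Finset.card (Finset.mem_filter.1 hβ).2
    rw [card_cycleEdges, card_cycleEdges, Nat.add_right_cancel_iff] at h
    rw [Fin.ext h]
  rw [classWeight, Finset.sum_congr rfl h1, Finset.sum_const, nsmul_eq_mul]
  congr 2
  refine Eq.trans (Eq.symm ?_) (card_filter_walkEdges_eq hw)
  refine Finset.card_bij (fun β hβ => ⟨l, β, (Finset.mem_filter.1 hβ).2.1⟩) ?_ ?_ ?_
  · intro β hβ
    exact Finset.mem_filter.2 ⟨Finset.mem_univ _, (Finset.mem_filter.1 hβ).2.2⟩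
  · intro β hβ β' hβ' h
    simpa using h
  · rintro ⟨l', w', hw'⟩ hβ
    have h' := (Finset.mem_filter.1 hβ).2
    have h := congrArg Finset.card h'
    rw [card_cycleEdges, card_cycleEdges, Nat.add_right_cancel_iff] at h
    obtain rfl : l' = l := Fin.ext h
    exact ⟨w', by simpa [cycleEdges, hw'] using h', rfl⟩

/-- The surplus edge of a partial overlap gives the factor `p`; the remaining powers of `p` are
summed by the vertex count relative to the vertices of `α`. In 2K, one K bounds the size of that
vertex set and the other the length of the overlapping walk. -/
theorem overlapWeight_cycleEdges_le (c : Fin K → ℝ) {p : ℝ} (hp : 0 ≤ p) (hp1 : p ≤ 1)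
    (α : CycleIndex V K) :
    overlapWeight cycleEdges (fun β : CycleIndex V K => c β.1) p α ≤
      p * ∑ l, |c l| * (Fintype.card V * p + 2 * K) ^ (l.val + 1) := by
  obtain ⟨a, w, hw⟩ := α
  set S := Finset.univ.image w with hS
  have hScard : (S.card : ℝ) ≤ K := by
    have h1 : S.card ≤ a.val + 1 := Finset.card_image_le.trans (by simp [ZMod.card])
    exact_mod_cast h1.trans a.2
  have h1 : ∀ β : CycleIndex V K, (if cycleEdges β ≠ cycleEdges ⟨a, w, hw⟩ ∧
      ¬ Disjoint (cycleEdges β) (cycleEdges ⟨a, w, hw⟩) then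
        |c β.1| * p ^ (cycleEdges β \ cycleEdges ⟨a, w, hw⟩).card else 0) ≤
      |c β.1| * (p * p ^ (Finset.univ.image β.2.1 \ S).card) := by
    rintro ⟨l, u, hu⟩
    split_ifs with h
    · refine mul_le_mul_of_nonneg_left ?_ (abs_nonneg _)
      rw [← pow_succ']
      refine pow_le_pow_of_le_one hp hp1 (card_sdiff_lt_card_walkEdges_sdiff h.2 fun hsub => h.1 ?_)
      exact walkEdges_eq_of_subset hw hsub
    · positivity
  rw [overlapWeight, Finset.sum_filter]
  refine (Finset.sum_le_sum fun β _ => h1 β).trans ?_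
  rw [Fintype.sum_sigma, Finset.mul_sum]
  refine Finset.sum_le_sum fun l _ => ?_
  simp only
  rw [← Finset.mul_sum, ← Finset.mul_sum, ← mul_assoc, mul_comm |c l| p, mul_assoc]
  refine mul_le_mul_of_nonneg_left (mul_le_mul_of_nonneg_left ?_ (abs_nonneg _)) hp
  rw [← Finset.sum_subtype (Finset.univ.filter Function.Injective) (by simp)
    (fun u : ZMod (l.val + 1) → V => p ^ (Finset.univ.image u \ S).card)]
  refine (Finset.sum_le_sum_of_subset_of_nonneg (Finset.filter_subset _ _)
    fun _ _ _ => by positivity).trans ((sum_pow_card_walk_image_sdiff_le hp S l.val).trans ?_)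
  refine pow_le_pow_left₀ (by positivity) ?_ _
  have : ((l.val + 1 : ℕ) : ℝ) ≤ K := by exact_mod_cast l.2
  linarith

/-- Mean number of injective closed walks of length `l + 1`. -/
noncomputable def cycleMean (n : ℕ) (p : ℝ) (l : ℕ) : ℝ := n.descFactorial (l + 1) * p ^ (l + 1)

/-- Number of injective closed walks of length `l + 1`. -/
def cycleCount (l : ℕ) (x : V × V → Bool) : ℝ :=
  ∑ u : ZMod (l + 1) → V with Function.Injective u, edgeInd (walkEdges u) x

theorem card_injective_walks (l : ℕ) :
    Fintype.card {w : ZMod (l + 1) → V // Function.Injective w} =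
      (Fintype.card V).descFactorial (l + 1) := by
  rw [Fintype.card_congr (Equiv.subtypeInjectiveEquivEmbedding _ _), Fintype.card_embedding_eq,
    ZMod.card]

theorem sum_cycleIndex (f : Fin K → ℝ) :
    ∑ α : CycleIndex V K, f α.1 =
      ∑ l, (Fintype.card V).descFactorial (l.val + 1) * f l := by
  rw [Fintype.sum_sigma]
  refine Finset.sum_congr rfl fun l _ => ?_
  change ∑ _y : {w : ZMod (l.val + 1) → V // Function.Injective w}, f l = _
  rw [Finset.sum_const, nsmul_eq_mul, Finset.card_univ, card_injective_walks]

theorem centeredSum_cycleEdges (c : Fin K → ℝ) (p : ℝ) (x : V × V → Bool) :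
    centeredSum cycleEdges (fun β : CycleIndex V K => c β.1) p x =
      ∑ l : Fin K, c l * (cycleCount l.val x - cycleMean (Fintype.card V) p l) := by
  rw [centeredSum, Fintype.sum_sigma]
  refine Finset.sum_congr rfl fun l _ => ?_
  simp only [card_cycleEdges]
  rw [← Finset.mul_sum, Finset.sum_sub_distrib, Finset.sum_const, nsmul_eq_mul, Finset.card_univ,
    card_injective_walks, cycleCount, cycleMean]
  congr 2
  rw [Finset.sum_subtype (p := Function.Injective) (Finset.univ.filter Function.Injective) (by simp)]
  rfl

/-- Limiting variance of a linear combination of cycle counts. -/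
noncomputable def cycleVar (n : ℕ) (p : ℝ) (c : Fin K → ℝ) : ℝ :=
  ∑ l : Fin K, cycleMean n p l * ((l.val + 1 : ℕ) * c l ^ 2)

/-- Error in the Gaussian approximation of a linear combination of cycle counts. -/
noncomputable def cycleErr (n : ℕ) (p : ℝ) (c : Fin K → ℝ) : ℝ :=
  ∑ l : Fin K, cycleMean n p l * (|c l| * ((l.val + 1 : ℕ) * |c l| * p ^ (l.val + 1) +
    p * ∑ j, |c j| * (n * p + 2 * K) ^ (j.val + 1) + 2 * ((l.val + 1 : ℕ) * c l) ^ 2))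

theorem norm_edgeCharFun_cycleEdges_sub_le (c : Fin K → ℝ) (p : unitInterval) :
    ‖edgeCharFun cycleEdges (fun β : CycleIndex V K => c β.1) p 1 -
      Complex.exp (-(cycleVar (Fintype.card V) p c / 2 : ℝ))‖ ≤
      cycleErr (Fintype.card V) p c * Real.exp |cycleVar (Fintype.card V) p c| := by
  have hp : (0 : ℝ) ≤ p := p.2.1
  refine norm_edgeCharFun_one_sub_le cycleEdges (fun β : CycleIndex V K => c β.1) p ?_ ?_
  · simp only [card_cycleEdges, classWeight_cycleEdges]
    rw [sum_cycleIndex fun l => c l * (p : ℝ) ^ (l.val + 1) * ((l.val + 1 : ℕ) * c l), cycleVar]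
    refine Finset.sum_congr rfl fun l _ => ?_
    rw [cycleMean]
    ring
  · have h : ∀ α : CycleIndex V K, |c α.1| * (p : ℝ) ^ (cycleEdges α).card *
        (|classWeight cycleEdges (fun β : CycleIndex V K => c β.1) α| *
          (p : ℝ) ^ (cycleEdges α).card +
          overlapWeight cycleEdges (fun β : CycleIndex V K => c β.1) p α +
          2 * classWeight cycleEdges (fun β : CycleIndex V K => c β.1) α ^ 2) ≤
        (fun l : Fin K => |c l| * (p : ℝ) ^ (l.val + 1) *
          ((l.val + 1 : ℕ) * |c l| * (p : ℝ) ^ (l.val + 1) +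
          p * ∑ j, |c j| * (Fintype.card V * p + 2 * K) ^ (j.val + 1) +
          2 * ((l.val + 1 : ℕ) * c l) ^ 2)) α.1 := by
      intro α
      simp only [card_cycleEdges, classWeight_cycleEdges]
      refine mul_le_mul_of_nonneg_left ?_ (by positivity)
      rw [abs_mul, Nat.abs_cast]
      gcongr
      exact overlapWeight_cycleEdges_le c hp p.2.2 α
    refine (Finset.sum_le_sum fun α _ => h α).trans_eq ?_
    rw [sum_cycleIndex fun l : Fin K => |c l| * (p : ℝ) ^ (l.val + 1) *
          ((l.val + 1 : ℕ) * |c l| * (p : ℝ) ^ (l.val + 1) +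
          p * ∑ j, |c j| * (Fintype.card V * p + 2 * K) ^ (j.val + 1) +
          2 * ((l.val + 1 : ℕ) * c l) ^ 2), cycleErr]
    refine Finset.sum_congr rfl fun l _ => ?_
    rw [cycleMean]
    ring

end Cycles

/-! ### Traces as cycle counts plus a negligible excess -/

section TracePowers

variable {V : Type*} [DecidableEq V] [Fintype V]

/-- The `0`-`1` matrix of an edge configuration. -/
def edgeMatrix (x : V × V → Bool) : Matrix V V ℝ := Matrix.of fun i j => if x (i, j) then 1 else 0

theorem trace_edgeMatrix_pow (x : V × V → Bool) (k : ℕ) :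
    (edgeMatrix x ^ (k + 1)).trace = ∑ w : ZMod (k + 1) → V, edgeInd (walkEdges w) x := by
  rw [Matrix.trace_pow_succ_eq_sum]
  refine Finset.sum_congr rfl fun w _ => ?_
  unfold edgeInd
  simp only [edgeMatrix, Matrix.of_apply]
  split_ifs with h
  · refine Finset.prod_eq_one fun i _ => ?_
    rw [if_pos (h _ (mem_walkEdges.2 ⟨i, rfl⟩))]
  · push Not at h
    obtain ⟨e, he, hx⟩ := h
    obtain ⟨i, rfl⟩ := mem_walkEdges.1 he
    exact Finset.prod_eq_zero (Finset.mem_univ i) (if_neg hx)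

open Classical in
/-- Number of closed walks of length `k + 1` whose edges do not form a single cycle. -/
noncomputable def excessCount (k : ℕ) (x : V × V → Bool) : ℝ :=
  ∑ w : ZMod (k + 1) → V with ¬ IsFunctionalWalk w, edgeInd (walkEdges w) x

theorem excessCount_nonneg (k : ℕ) (x : V × V → Bool) : 0 ≤ excessCount k x :=
  Finset.sum_nonneg fun _ _ => edgeInd_nonneg _ _

theorem trace_edgeMatrix_pow_eq_add {K : ℕ} (k : Fin K) (x : V × V → Bool) :
    (edgeMatrix x ^ (k.val + 1)).trace =
      ∑ l : Fin K with l.val + 1 ∣ k.val + 1, cycleCount l.val x + excessCount k.val x := by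
  classical
  rw [trace_edgeMatrix_pow, ← Finset.sum_filter_add_sum_filter_not _ IsFunctionalWalk,
    sum_isFunctionalWalk (fun T => edgeInd T x) k.2]
  unfold cycleCount excessCount
  congr!

/-- A non-functional walk has at least one more edge than vertices; the surplus edge is the
prefactor `p`. -/
theorem integral_excessCount_le (p : unitInterval) (k : ℕ) :
    ∫ x, excessCount k x ∂edgeMeasure (V × V) p ≤
      p * (Fintype.card V * p + (k + 1 : ℕ)) ^ (k + 1) := by
  classical
  have hp : (0 : ℝ) ≤ p := p.2.1
  unfold excessCount
  rw [integral_finsetSum _ fun _ _ => integrable_edgeMeasure _ _]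
  simp_rw [integral_edgeInd]
  have h := sum_pow_card_walk_image_sdiff_le hp (∅ : Finset V) k
  simp only [Finset.sdiff_empty, Finset.card_empty, Nat.cast_zero, add_zero] at h
  refine le_trans ?_ (mul_le_mul_of_nonneg_left h hp)
  rw [Finset.mul_sum]
  refine (Finset.sum_le_sum fun w hw => ?_).trans
    (Finset.sum_le_sum_of_subset_of_nonneg (Finset.filter_subset _ _) fun _ _ _ => by positivity)
  rw [← pow_succ']
  exact pow_le_pow_of_le_one hp p.2.2 (card_image_lt_card_walkEdges (Finset.mem_filter.1 hw).2)

variable {K : ℕ}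

/-- Linear combination of the normalized traces of powers. -/
noncomputable def traceComb (t : Fin K → ℝ) (q : ℝ) (B : Matrix V V ℝ) : ℝ :=
  ∑ k : Fin K, t k * ((B ^ (k.val + 1)).trace / q ^ (k.val + 1) - q ^ (k.val + 1))

/-- Coefficient of the count of cycles of length `l + 1` in `traceComb`. -/
noncomputable def cycleCoeff (t : Fin K → ℝ) (q : ℝ) (l : Fin K) : ℝ :=
  ∑ k : Fin K with l.val + 1 ∣ k.val + 1, t k / q ^ (k.val + 1)

/-- Mean of the cycle contribution to `traceComb`. -/
noncomputable def traceShift (n : ℕ) (p : ℝ) (t : Fin K → ℝ) (q : ℝ) : ℝ :=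
  ∑ k : Fin K, t k * ((∑ l : Fin K with l.val + 1 ∣ k.val + 1, cycleMean n p l.val) /
    q ^ (k.val + 1) - q ^ (k.val + 1))

/-- Bound on the contribution to `traceComb` of walks which are not cycles. -/
noncomputable def excessBound (n : ℕ) (p : ℝ) (t : Fin K → ℝ) (q : ℝ) : ℝ :=
  ∑ k : Fin K, |t k| / |q| ^ (k.val + 1) * (p * (n * p + (k.val + 1 : ℕ)) ^ (k.val + 1))

theorem traceComb_edgeMatrix (t : Fin K → ℝ) (q p : ℝ) (x : V × V → Bool) :
    traceComb t q (edgeMatrix x) =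
      centeredSum cycleEdges (fun β : CycleIndex V K => cycleCoeff t q β.1) p x +
        traceShift (Fintype.card V) p t q +
        ∑ k : Fin K, t k / q ^ (k.val + 1) * excessCount k.val x := by
  -- Exchanges the sum over powers with the sum over the cycle lengths dividing them.
  have h : ∀ f : Fin K → ℝ, ∑ l, cycleCoeff t q l * f l =
      ∑ k : Fin K, t k / q ^ (k.val + 1) * ∑ l : Fin K with l.val + 1 ∣ k.val + 1, f l := by
    intro f
    simp only [cycleCoeff, Finset.sum_filter, Finset.mul_sum, Finset.sum_mul]
    rw [Finset.sum_comm]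
    refine Finset.sum_congr rfl fun k _ => Finset.sum_congr rfl fun l _ => ?_
    split_ifs <;> simp
  rw [centeredSum_cycleEdges, h, traceComb, traceShift, ← Finset.sum_add_distrib,
    ← Finset.sum_add_distrib]
  refine Finset.sum_congr rfl fun k _ => ?_
  rw [trace_edgeMatrix_pow_eq_add, Finset.sum_sub_distrib]
  ring

/-- The excess `R` enters only through |exp(iR) - 1| ≤ |R|, so a first-moment bound on it is enough.
-/
theorem norm_integral_exp_traceComb_sub_le (t : Fin K → ℝ) (q : ℝ) (p : unitInterval) :
    ‖∫ x, Complex.exp ((traceComb t q (edgeMatrix x) : ℝ) * Complex.I) ∂edgeMeasure (V × V) p -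
      Complex.exp ((traceShift (Fintype.card V) p t q : ℝ) * Complex.I) *
      Complex.exp (-(cycleVar (Fintype.card V) p (cycleCoeff t q) / 2 : ℝ))‖ ≤
      excessBound (Fintype.card V) p t q +
      cycleErr (Fintype.card V) p (cycleCoeff t q) *
        Real.exp |cycleVar (Fintype.card V) p (cycleCoeff t q)| := by
  set b := traceShift (Fintype.card V) p t q with hb
  set W := centeredSum cycleEdges (fun β : CycleIndex V K => cycleCoeff t q β.1) (p : ℝ) with hW
  set R : (V × V → Bool) → ℝ := fun x => ∑ k : Fin K, t k / q ^ (k.val + 1) * excessCount k.val x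
    with hR
  have h1 : ‖∫ x, Complex.exp ((traceComb t q (edgeMatrix x) : ℝ) * Complex.I)
      ∂edgeMeasure (V × V) p - Complex.exp ((b : ℝ) * Complex.I) *
      edgeCharFun cycleEdges (fun β : CycleIndex V K => cycleCoeff t q β.1) p 1‖ ≤
      excessBound (Fintype.card V) p t q := by
    rw [edgeCharFun, ← integral_const_mul,
      ← integral_sub (integrable_edgeMeasure _ _) (integrable_edgeMeasure _ _)]
    have hpt : ∀ x, ‖Complex.exp ((traceComb t q (edgeMatrix x) : ℝ) * Complex.I) -
        Complex.exp ((b : ℝ) * Complex.I) * Complex.exp ((1 * W x : ℝ) * Complex.I)‖ ≤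
        ∑ k : Fin K, |t k| / |q| ^ (k.val + 1) * excessCount k.val x := by
      intro x
      have : Complex.exp ((traceComb t q (edgeMatrix x) : ℝ) * Complex.I) -
        Complex.exp ((b : ℝ) * Complex.I) * Complex.exp ((1 * W x : ℝ) * Complex.I) =
        Complex.exp ((b + W x : ℝ) * Complex.I) * (Complex.exp (Complex.I * (R x : ℝ)) - 1) := by
        have e : traceComb t q (edgeMatrix x) = b + W x + R x := by
          rw [traceComb_edgeMatrix t q (p : ℝ) x, ← hb, ← hW, add_comm (W x)]
        rw [mul_sub, ← Complex.exp_add, ← Complex.exp_add, mul_one, e]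
        congr 2 <;> push_cast <;> ring
      rw [this, norm_mul, Complex.norm_exp_ofReal_mul_I, one_mul]
      refine Real.norm_exp_I_mul_ofReal_sub_one_le.trans
        ((Finset.abs_sum_le_sum_abs _ _).trans_eq (Finset.sum_congr rfl fun k _ => ?_))
      rw [abs_mul, abs_div, abs_pow, abs_of_nonneg (excessCount_nonneg _ _)]
    refine (norm_integral_le_integral_norm _).trans
      ((integral_mono (integrable_edgeMeasure _ _) (integrable_edgeMeasure _ _) hpt).trans ?_)
    rw [integral_finsetSum _ fun _ _ => integrable_edgeMeasure _ _, excessBound]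
    refine Finset.sum_le_sum fun k _ => ?_
    rw [integral_const_mul]
    exact mul_le_mul_of_nonneg_left (integral_excessCount_le p k.val) (by positivity)
  have h2 := norm_edgeCharFun_cycleEdges_sub_le (V := V) (cycleCoeff t q) p
  refine (norm_sub_le_norm_sub_add_norm_sub _ _ _).trans (add_le_add h1 ?_)
  rw [← mul_sub, norm_mul, Complex.norm_exp_ofReal_mul_I, one_mul]
  exact h2

end TracePowers

/-! ### Limits of the mean, the variance and the errors -/

section Asymptotics

theorem tendsto_pow_div_natCast_of_log {d : ℕ → ℝ} (hd_top : Tendsto d atTop atTop)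
    (hd_log : Tendsto (fun n : ℕ => Real.log (d n) / Real.log n) atTop (𝓝 0)) (m : ℕ) :
    Tendsto (fun n => d n ^ m / n) atTop (𝓝 0) := by
  have hlim : Tendsto (fun n : ℕ => (Real.sqrt n)⁻¹) atTop (𝓝 0) :=
    tendsto_inv_atTop_zero.comp (Real.tendsto_sqrt_atTop.comp tendsto_natCast_atTop_atTop)
  -- With this bound on the ratio of logarithms, d^m ≤ √n eventually; `m + 1` keeps the denominator
  -- nonzero when m = 0.
  have hε : (0 : ℝ) < 1 / (2 * (m + 1)) := by positivity
  refine tendsto_of_tendsto_of_tendsto_of_le_of_le' tendsto_const_nhds hlim ?_ ?_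
  · filter_upwards [hd_top.eventually_ge_atTop 0] with n hn
    positivity
  · filter_upwards [hd_top.eventually_gt_atTop 0, hd_log.eventually_lt_const hε,
      eventually_gt_atTop 1] with n hn hlog hn1
    have hn1' : (1 : ℝ) < n := by exact_mod_cast hn1
    have hL : 0 < Real.log n := Real.log_pos hn1'
    have hn0 : (0 : ℝ) < n := by linarith
    rw [div_lt_div_iff₀ hL (by positivity)] at hlog
    have h1 : d n ^ m ≤ Real.sqrt n := by
      rw [← Real.log_le_log_iff (by positivity) (Real.sqrt_pos.2 hn0), Real.log_pow,
        Real.log_sqrt hn0.le]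
      have hm : (0 : ℝ) ≤ m := by positivity
      by_cases h : 0 ≤ Real.log (d n)
      · nlinarith
      · nlinarith
    calc d n ^ m / n ≤ Real.sqrt n / n := by gcongr
      _ = (Real.sqrt n)⁻¹ := by
        rw [Real.sqrt_div_self']
        exact one_div _

/-- Every factor of the falling factorial is at least n - k; Bernoulli's inequality does the rest.
-/
theorem one_sub_descFactorial_div_pow_le {n k : ℕ} (hn : k ≤ n) (hn0 : 0 < n) :
    1 - (n.descFactorial k : ℝ) / n ^ k ≤ k ^ 2 / n := by
  have hn' : (0 : ℝ) < n := by exact_mod_cast hn0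
  have h1 : ((n + 1 - k : ℕ) : ℝ) ^ k ≤ n.descFactorial k := by
    exact_mod_cast Nat.pow_sub_le_descFactorial n k
  have h2 : ((n : ℝ) - k) ^ k ≤ n.descFactorial k := by
    refine le_trans (pow_le_pow_left₀ ?_ ?_ _) h1
    · rw [sub_nonneg]; exact_mod_cast hn
    · rw [Nat.cast_sub (by omega)]
      push_cast
      linarith
  have hkn : (k : ℝ) / n ≤ 1 := by
    rw [div_le_one hn']
    exact_mod_cast hn
  have h3 : 1 + (k : ℝ) * (-(k / n)) ≤ (1 + -((k : ℝ) / n)) ^ k :=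
    one_add_mul_le_pow (by linarith) k
  have h4 : (1 + -((k : ℝ) / n)) ^ k = ((n : ℝ) - k) ^ k / n ^ k := by
    rw [← div_pow]
    congr 1
    field_simp
    ring
  have h5 : ((n : ℝ) - k) ^ k / n ^ k ≤ n.descFactorial k / n ^ k := by gcongr
  have h6 : (k : ℝ) * (-(k / n)) = - (k ^ 2 / n) := by ring
  linarith

theorem tendsto_pow_mul_one_sub_descFactorial {q : ℕ → ℝ} (hq : Tendsto q atTop atTop)
    (hpow : ∀ m : ℕ, Tendsto (fun n => q n ^ m / n) atTop (𝓝 0)) (a k : ℕ) :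
    Tendsto (fun n : ℕ => q n ^ a * (1 - (n.descFactorial k : ℝ) / n ^ k)) atTop (𝓝 0) := by
  have hlim : Tendsto (fun n : ℕ => (k : ℝ) ^ 2 * (q n ^ a / n)) atTop (𝓝 0) := by
    simpa using (hpow a).const_mul ((k : ℝ) ^ 2)
  refine tendsto_of_tendsto_of_tendsto_of_le_of_le' tendsto_const_nhds hlim ?_ ?_
  · filter_upwards [hq.eventually_ge_atTop 0] with n hn
    refine mul_nonneg (by positivity) (sub_nonneg.2 (div_le_one_of_le₀ ?_ (by positivity)))
    exact_mod_cast Nat.descFactorial_le_pow n k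
  · filter_upwards [hq.eventually_ge_atTop 0, eventually_ge_atTop k, eventually_gt_atTop 0]
      with n hn hk hn0
    calc _ ≤ q n ^ a * (k ^ 2 / n) :=
          mul_le_mul_of_nonneg_left (one_sub_descFactorial_div_pow_le hk hn0) (by positivity)
      _ = _ := by ring

theorem cycleMean_eq (n : ℕ) (q : ℝ) (l : ℕ) : cycleMean n (q ^ 2 / n) l =
    (n.descFactorial (l + 1) : ℝ) / n ^ (l + 1) * q ^ (2 * (l + 1)) := by
  rw [cycleMean, div_pow, ← pow_mul]
  ring

theorem tendsto_descFactorial_div_pow {q : ℕ → ℝ} (hq : Tendsto q atTop atTop)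
    (hpow : ∀ m : ℕ, Tendsto (fun n => q n ^ m / n) atTop (𝓝 0)) (k : ℕ) :
    Tendsto (fun n : ℕ => (n.descFactorial k : ℝ) / n ^ k) atTop (𝓝 1) := by
  have := (tendsto_pow_mul_one_sub_descFactorial hq hpow 0 k).const_sub 1
  simpa using this

theorem tendsto_pow_div_pow_zero {q : ℕ → ℝ} (hq : Tendsto q atTop atTop) {a b : ℕ} (h : a < b) :
    Tendsto (fun n => q n ^ a / q n ^ b) atTop (𝓝 0) :=
  (tendsto_pow_div_pow_atTop_zero h).comp hq

/-- A proper multiple of the cycle length contributes a negative power of `q`, so only the power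
equal to the length survives. -/
theorem tendsto_cycleCoeff_mul_pow {K : ℕ} (t : Fin K → ℝ) {q : ℕ → ℝ}
    (hq : Tendsto q atTop atTop) (l : Fin K) :
    Tendsto (fun n => cycleCoeff t (q n) l * q n ^ (l.val + 1)) atTop (𝓝 (t l)) := by
  simp only [cycleCoeff, Finset.sum_mul]
  have h : ∀ k ∈ Finset.univ.filter fun k : Fin K => l.val + 1 ∣ k.val + 1,
      Tendsto (fun n => t k / q n ^ (k.val + 1) * q n ^ (l.val + 1)) atTop
        (𝓝 (if k = l then t k else 0)) := by
    intro k hk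
    split_ifs with h
    · subst h
      refine tendsto_const_nhds.congr' ?_
      filter_upwards [hq.eventually_gt_atTop 0] with n hn
      rw [div_mul_cancel₀ _ (by positivity)]
    · have hle := Nat.le_of_dvd k.val.succ_pos (Finset.mem_filter.1 hk).2
      have hlt : l.val + 1 < k.val + 1 := lt_of_le_of_ne hle fun e => h (Fin.ext (by omega))
      have := (tendsto_pow_div_pow_zero hq hlt).const_mul (t k)
      rw [mul_zero] at this
      exact this.congr fun n => by ring
  have := tendsto_finsetSum _ h
  simpa using this

theorem tendsto_cycleCoeff {K : ℕ} (t : Fin K → ℝ) {q : ℕ → ℝ}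
    (hq : Tendsto q atTop atTop) (l : Fin K) :
    Tendsto (fun n => cycleCoeff t (q n) l) atTop (𝓝 0) := by
  have h1 : Tendsto (fun n => (q n ^ (l.val + 1))⁻¹) atTop (𝓝 0) :=
    tendsto_inv_atTop_zero.comp ((tendsto_pow_atTop l.val.succ_ne_zero).comp hq)
  have := (tendsto_cycleCoeff_mul_pow t hq l).mul h1
  rw [mul_zero] at this
  refine this.congr' ?_
  filter_upwards [hq.eventually_gt_atTop 0] with n hn
  rw [mul_assoc, mul_inv_cancel₀ (by positivity), mul_one]

theorem tendsto_cycleMean_mul_sq {K : ℕ} (t : Fin K → ℝ) {q : ℕ → ℝ}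
    (hq : Tendsto q atTop atTop)
    (hpow : ∀ m : ℕ, Tendsto (fun n => q n ^ m / n) atTop (𝓝 0)) (l : Fin K) :
    Tendsto (fun n : ℕ => cycleMean n (q n ^ 2 / n) l * cycleCoeff t (q n) l ^ 2) atTop
      (𝓝 (t l ^ 2)) := by
  have := (tendsto_descFactorial_div_pow hq hpow (l.val + 1)).mul
    ((tendsto_cycleCoeff_mul_pow t hq l).pow 2)
  rw [one_mul] at this
  refine this.congr fun n => ?_
  rw [cycleMean_eq]
  ring

theorem tendsto_cycleVar {K : ℕ} (t : Fin K → ℝ) {q : ℕ → ℝ} (hq : Tendsto q atTop atTop)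
    (hpow : ∀ m : ℕ, Tendsto (fun n => q n ^ m / n) atTop (𝓝 0)) :
    Tendsto (fun n : ℕ => cycleVar n (q n ^ 2 / n) (cycleCoeff t (q n))) atTop
      (𝓝 (∑ l : Fin K, (l.val + 1 : ℕ) * t l ^ 2)) := by
  refine tendsto_finsetSum _ fun l _ => ?_
  refine ((tendsto_cycleMean_mul_sq t hq hpow l).const_mul ((l.val + 1 : ℕ) : ℝ)).congr fun n => ?_
  ring

/-- Since np = q², the bracket is eventually at most 2q², and the whole is a power of `q` divided by
n. -/
theorem tendsto_pow_mul_mean_degree_pow {q : ℕ → ℝ} (hq : Tendsto q atTop atTop)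
    (hpow : ∀ m : ℕ, Tendsto (fun n => q n ^ m / n) atTop (𝓝 0)) (a m : ℕ) {C : ℝ} (hC : 0 ≤ C) :
    Tendsto (fun n : ℕ => q n ^ a * (q n ^ 2 / n * (n * (q n ^ 2 / n) + C) ^ m)) atTop (𝓝 0) := by
  have hlim : Tendsto (fun n : ℕ => 2 ^ m * (q n ^ (a + 2 + 2 * m) / n)) atTop (𝓝 0) := by
    simpa using (hpow (a + 2 + 2 * m)).const_mul ((2 : ℝ) ^ m)
  refine tendsto_of_tendsto_of_tendsto_of_le_of_le' tendsto_const_nhds hlim ?_ ?_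
  · filter_upwards [hq.eventually_ge_atTop 0] with n hn
    positivity
  · filter_upwards [hq.eventually_ge_atTop 1, hq.eventually_ge_atTop C, eventually_gt_atTop 0]
      with n hn hnC hn0
    have hn0' : (n : ℝ) ≠ 0 := by exact_mod_cast hn0.ne'
    have h1 : (n : ℝ) * (q n ^ 2 / n) + C ≤ 2 * q n ^ 2 := by
      rw [mul_div_cancel₀ _ hn0']
      nlinarith
    calc _ ≤ q n ^ a * (q n ^ 2 / n * (2 * q n ^ 2) ^ m) := by gcongr
      _ = _ := by rw [mul_pow, ← pow_mul]; ring

theorem tendsto_excessBound {K : ℕ} (t : Fin K → ℝ) {q : ℕ → ℝ} (hq : Tendsto q atTop atTop)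
    (hpow : ∀ m : ℕ, Tendsto (fun n => q n ^ m / n) atTop (𝓝 0)) :
    Tendsto (fun n : ℕ => excessBound n (q n ^ 2 / n) t (q n)) atTop (𝓝 0) := by
  have h : ∀ k ∈ (Finset.univ : Finset (Fin K)), Tendsto (fun n : ℕ =>
      |t k| / |q n| ^ (k.val + 1) *
        (q n ^ 2 / n * (n * (q n ^ 2 / n) + (k.val + 1 : ℕ)) ^ (k.val + 1))) atTop (𝓝 0) := by
    intro k _
    have h1 : Tendsto (fun n => |t k| / |q n| ^ (k.val + 1)) atTop (𝓝 0) :=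
      tendsto_const_nhds.div_atTop
        ((tendsto_pow_atTop k.val.succ_ne_zero).comp (tendsto_abs_atTop_atTop.comp hq))
    have h2 := tendsto_pow_mul_mean_degree_pow hq hpow 0 (k.val + 1)
      (Nat.cast_nonneg (α := ℝ) (k.val + 1))
    simpa using h1.mul h2
  simpa [excessBound] using tendsto_finsetSum _ h

theorem tendsto_cycleErr {K : ℕ} (t : Fin K → ℝ) {q : ℕ → ℝ} (hq : Tendsto q atTop atTop)
    (hpow : ∀ m : ℕ, Tendsto (fun n => q n ^ m / n) atTop (𝓝 0)) :
    Tendsto (fun n : ℕ => cycleErr n (q n ^ 2 / n) (cycleCoeff t (q n))) atTop (𝓝 0) := by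
  have habs : ∀ l, Tendsto (fun n => |cycleCoeff t (q n) l|) atTop (𝓝 0) := fun l => by
    simpa using (tendsto_cycleCoeff t hq l).abs
  have h : ∀ l ∈ (Finset.univ : Finset (Fin K)), Tendsto (fun n : ℕ =>
      cycleMean n (q n ^ 2 / n) l.val * (|cycleCoeff t (q n) l| *
        ((l.val + 1 : ℕ) * |cycleCoeff t (q n) l| * (q n ^ 2 / n) ^ (l.val + 1) +
        q n ^ 2 / n * ∑ j, |cycleCoeff t (q n) j| * (n * (q n ^ 2 / n) + 2 * K) ^ (j.val + 1) +
        2 * ((l.val + 1 : ℕ) * cycleCoeff t (q n) l) ^ 2))) atTop (𝓝 0) := by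
    intro l _
    have hsq := tendsto_cycleMean_mul_sq t hq hpow l
    -- The three errors in turn: `h1` for α being already present, `h2` for partial overlaps, `h3`
    -- for the second-order term. The first and third are a bounded variance term times a vanishing
    -- factor.
    have h1 : Tendsto (fun n : ℕ => (l.val + 1 : ℕ) *
        (cycleMean n (q n ^ 2 / n) l.val * cycleCoeff t (q n) l ^ 2) *
        (q n ^ 2 / n) ^ (l.val + 1)) atTop (𝓝 0) := by
      simpa using (hsq.const_mul ((l.val + 1 : ℕ) : ℝ)).mul ((hpow 2).pow (l.val + 1))
    have h2 : Tendsto (fun n : ℕ => ∑ j : Fin K,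
        (n.descFactorial (l.val + 1) : ℝ) / n ^ (l.val + 1) * |cycleCoeff t (q n) l| *
        |cycleCoeff t (q n) j| * (q n ^ (2 * (l.val + 1)) * (q n ^ 2 / n *
          (n * (q n ^ 2 / n) + 2 * K) ^ (j.val + 1)))) atTop (𝓝 0) := by
      have e : 𝓝 (0 : ℝ) = 𝓝 (∑ _j : Fin K, (0 : ℝ)) := by simp
      rw [e]
      refine tendsto_finsetSum _ fun j _ => ?_
      simpa using (((tendsto_descFactorial_div_pow hq hpow (l.val + 1)).mul (habs l)).mul
        (habs j)).mul (tendsto_pow_mul_mean_degree_pow hq hpow (2 * (l.val + 1)) (j.val + 1)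
          (C := 2 * K) (by positivity))
    have h3 : Tendsto (fun n : ℕ => 2 * ((l.val + 1 : ℕ) : ℝ) ^ 2 *
        (cycleMean n (q n ^ 2 / n) l.val * cycleCoeff t (q n) l ^ 2) *
        |cycleCoeff t (q n) l|) atTop (𝓝 0) := by
      simpa using (hsq.const_mul (2 * ((l.val + 1 : ℕ) : ℝ) ^ 2)).mul (habs l)
    have h4 := (h1.add h2).add h3
    simp only [add_zero] at h4
    refine h4.congr fun n => ?_
    have h5 : ∑ j : Fin K, (n.descFactorial (l.val + 1) : ℝ) / n ^ (l.val + 1) *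
        |cycleCoeff t (q n) l| * |cycleCoeff t (q n) j| * (q n ^ (2 * (l.val + 1)) * (q n ^ 2 / n *
          (n * (q n ^ 2 / n) + 2 * K) ^ (j.val + 1))) =
        cycleMean n (q n ^ 2 / n) l.val * |cycleCoeff t (q n) l| * (q n ^ 2 / n *
          ∑ j, |cycleCoeff t (q n) j| * (n * (q n ^ 2 / n) + 2 * K) ^ (j.val + 1)) := by
      rw [Finset.mul_sum, Finset.mul_sum, cycleMean_eq]
      exact Finset.sum_congr rfl fun j _ => by ring
    rw [h5, mul_pow _ (cycleCoeff t (q n) l) 2, ← sq_abs (cycleCoeff t (q n) l)]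
    ring
  simpa [cycleErr] using tendsto_finsetSum _ h

/-- For length l dividing k, the normalised mean behaves like q^(2l-k). The case l = k cancels the
centering up to q^k·O(1/n), l = k/2 gives 1, and smaller divisors give 0. -/
theorem tendsto_traceShift {K : ℕ} (t : Fin K → ℝ) {q : ℕ → ℝ} (hq : Tendsto q atTop atTop)
    (hpow : ∀ m : ℕ, Tendsto (fun n => q n ^ m / n) atTop (𝓝 0)) :
    Tendsto (fun n : ℕ => traceShift n (q n ^ 2 / n) t (q n)) atTop
      (𝓝 (∑ k : Fin K, t k * if Even (k.val + 1) then 1 else 0)) := by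
  refine tendsto_finsetSum _ fun k _ => Tendsto.const_mul _ ?_
  set s := Finset.univ.filter fun l : Fin K => l.val + 1 ∣ k.val + 1 with hs
  have hks : k ∈ s := by simp [hs]
  have h1 : ∀ l ∈ s.erase k, Tendsto (fun n : ℕ => cycleMean n (q n ^ 2 / n) l.val /
      q n ^ (k.val + 1)) atTop (𝓝 (if 2 * (l.val + 1) = k.val + 1 then 1 else 0)) := by
    intro l hl
    have hlk : l ≠ k := Finset.ne_of_mem_erase hl
    obtain ⟨c, hc⟩ : l.val + 1 ∣ k.val + 1 := (Finset.mem_filter.1 (Finset.mem_of_mem_erase hl)).2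
    -- A proper divisor is at most half.
    have hc2 : 2 ≤ c := by
      rcases c with - | - | c
      · simp at hc
      · exact absurd (Fin.ext (by simpa using hc.symm)) hlk
      · omega
    have hle : 2 * (l.val + 1) ≤ k.val + 1 := by
      rw [hc, mul_comm]
      exact Nat.mul_le_mul_left _ hc2
    have h2 : Tendsto (fun n => q n ^ (2 * (l.val + 1)) / q n ^ (k.val + 1)) atTop
        (𝓝 (if 2 * (l.val + 1) = k.val + 1 then 1 else 0)) := by
      split_ifs with h
      · rw [h]
        refine tendsto_const_nhds.congr' ?_
        filter_upwards [hq.eventually_gt_atTop 0] with n hn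
        rw [div_self (by positivity)]
      · exact tendsto_pow_div_pow_zero hq (lt_of_le_of_ne hle h)
    have h3 := (tendsto_descFactorial_div_pow hq hpow (l.val + 1)).mul h2
    rw [one_mul] at h3
    refine h3.congr fun n => ?_
    rw [cycleMean_eq, mul_div_assoc]
  have h2 := (tendsto_finsetSum _ h1).sub
    (tendsto_pow_mul_one_sub_descFactorial hq hpow (k.val + 1) (k.val + 1))
  have h3 : ∑ l ∈ s.erase k, (if 2 * (l.val + 1) = k.val + 1 then (1 : ℝ) else 0) - 0 =
      if Even (k.val + 1) then 1 else 0 := by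
    rw [sub_zero]
    split_ifs with h
    · obtain ⟨r, hr⟩ := h
      have hr1 : r - 1 < K := by have := k.2; omega
      rw [Finset.sum_eq_single_of_mem (⟨r - 1, hr1⟩ : Fin K)]
      · rw [if_pos]
        simp only
        omega
      · refine Finset.mem_erase.2 ⟨fun e => ?_, Finset.mem_filter.2 ⟨Finset.mem_univ _, ?_⟩⟩
        · have := congrArg Fin.val e
          simp only at this
          omega
        · refine ⟨2, ?_⟩
          simp only
          omega
      · intro l _ hl
        rw [if_neg]
        intro e
        exact hl (Fin.ext (by simp only; omega))
    · refine Finset.sum_eq_zero fun l _ => if_neg fun e => h ⟨l.val + 1, by omega⟩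
  rw [h3] at h2
  refine h2.congr' ?_
  filter_upwards [hq.eventually_gt_atTop 0] with n hn
  rw [← Finset.add_sum_erase _ _ hks, add_div, Finset.sum_div, cycleMean_eq n (q n) k.val]
  field_simp
  ring

theorem tendsto_integral_exp_traceComb {K : ℕ} (t : Fin K → ℝ) {d : ℕ → ℝ}
    (hd : ∀ n : ℕ, d n / n ∈ unitInterval) (hd_top : Tendsto d atTop atTop)
    (hd_log : Tendsto (fun n : ℕ => Real.log (d n) / Real.log n) atTop (𝓝 0)) :
    Tendsto (fun n : ℕ => ∫ x, Complex.exp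
        ((traceComb t (Real.sqrt (d n)) (edgeMatrix x) : ℝ) * Complex.I)
        ∂edgeMeasure (Fin n × Fin n) ⟨d n / n, hd n⟩) atTop
      (𝓝 (Complex.exp (((∑ k : Fin K, t k * if Even (k.val + 1) then 1 else 0 : ℝ) : ℂ) *
          Complex.I) *
        Complex.exp (-((∑ l : Fin K, (l.val + 1 : ℕ) * t l ^ 2) / 2 : ℝ)))) := by
  set q : ℕ → ℝ := fun n => Real.sqrt (d n) with hqdef
  have hq : Tendsto q atTop atTop := Real.tendsto_sqrt_atTop.comp hd_top
  have hpow : ∀ m : ℕ, Tendsto (fun n => q n ^ m / n) atTop (𝓝 0) := by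
    intro m
    refine tendsto_of_tendsto_of_tendsto_of_le_of_le' tendsto_const_nhds
      (tendsto_pow_div_natCast_of_log hd_top hd_log m) ?_ ?_
    · filter_upwards [hq.eventually_ge_atTop 0] with n hn
      positivity
    -- Once d ≥ 1, √d ≤ d, so the bound for powers of d passes to powers of `q`.
    · filter_upwards [hd_top.eventually_ge_atTop 1] with n hn
      have : q n ≤ d n := by
        rw [hqdef]
        exact Real.sqrt_le_iff.2 ⟨by linarith, by nlinarith⟩
      have h0 : 0 ≤ q n := Real.sqrt_nonneg _
      gcongr
  have hsq : ∀ᶠ n in atTop, d n = q n ^ 2 := by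
    filter_upwards [hd_top.eventually_ge_atTop 0] with n hn
    rw [hqdef, Real.sq_sqrt hn]
  have hmain : Tendsto (fun n : ℕ =>
      Complex.exp ((traceShift n (q n ^ 2 / n) t (q n) : ℝ) * Complex.I) *
      Complex.exp (-(cycleVar n (q n ^ 2 / n) (cycleCoeff t (q n)) / 2 : ℝ))) atTop
      (𝓝 (Complex.exp (((∑ k : Fin K, t k * if Even (k.val + 1) then 1 else 0 : ℝ) : ℂ) *
          Complex.I) *
        Complex.exp (-((∑ l : Fin K, (l.val + 1 : ℕ) * t l ^ 2) / 2 : ℝ)))) := by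
    refine Tendsto.mul ?_ ?_
    · exact (Complex.continuous_exp.tendsto _).comp
        (((Complex.continuous_ofReal.tendsto _).comp (tendsto_traceShift t hq hpow)).mul_const _)
    · exact (Complex.continuous_exp.tendsto _).comp
        (((Complex.continuous_ofReal.tendsto _).comp
          ((tendsto_cycleVar t hq hpow).div_const 2)).neg)
  have herr : Tendsto (fun n : ℕ => excessBound n (q n ^ 2 / n) t (q n) +
      cycleErr n (q n ^ 2 / n) (cycleCoeff t (q n)) *
        Real.exp |cycleVar n (q n ^ 2 / n) (cycleCoeff t (q n))|) atTop (𝓝 0) := by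
    have := (tendsto_excessBound t hq hpow).add ((tendsto_cycleErr t hq hpow).mul
      ((Real.continuous_exp.tendsto _).comp (tendsto_cycleVar t hq hpow).abs))
    simpa using this
  refine (tendsto_iff_of_dist ?_).2 hmain
  refine squeeze_zero' (Eventually.of_forall fun _ => dist_nonneg) ?_ herr
  filter_upwards [hsq] with n hn
  have := norm_integral_exp_traceComb_sub_le (V := Fin n) t (q n) ⟨d n / n, hd n⟩
  simp only [Fintype.card_fin] at this
  rw [dist_eq_norm, ← hn]
  exact this

end Asymptotics

/-! ### From characteristic functions to convergence in law -/

section Transfer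

/-- A random matrix with independent Bernoulli entries is distributed as the `0`-`1` matrix of
independent edges. -/
theorem map_bernoulli_entries {V Ω : Type*} [Fintype V] [DecidableEq V] [MeasurableSpace Ω]
    {P : Measure Ω} [IsProbabilityMeasure P] {A : Ω → Matrix V V ℝ} {p : unitInterval}
    (hlaw : ∀ i j, HasLaw (fun ω => A ω i j) (bernoulliMeasure (1 : ℝ) 0 p) P)
    (hindep : iIndepFun (fun (e : V × V) ω => A ω e.1 e.2) P) :
    P.map (fun ω (e : V × V) => A ω e.1 e.2) =
      (edgeMeasure (V × V) p).map fun x e => if x e = true then (1 : ℝ) else 0 := by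
  refine ((iIndepFun_iff_map_fun_eq_pi_map fun e : V × V =>
    (hlaw e.1 e.2).aemeasurable).1 hindep).trans ?_
  rw [edgeMeasure, Measure.pi_map_pi (f := fun _ b => if b = true then (1 : ℝ) else 0)
      fun _ => Measurable.of_discrete.aemeasurable]
  congr 1
  funext e
  rw [(hlaw e.1 e.2).map_eq, map_bernoulliMeasure' _ _ .of_discrete]
  simp

theorem continuous_traceComb {V : Type*} [Fintype V] [DecidableEq V] {K : ℕ} (t : Fin K → ℝ)
    (q : ℝ) : Continuous (traceComb t q : Matrix V V ℝ → ℝ) := by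
  unfold traceComb
  fun_prop

theorem integral_exp_traceComb_eq {V Ω : Type*} [Fintype V] [DecidableEq V] [MeasurableSpace Ω]
    {P : Measure Ω} [IsProbabilityMeasure P] {A : Ω → Matrix V V ℝ} {p : unitInterval}
    (hlaw : ∀ i j, HasLaw (fun ω => A ω i j) (bernoulliMeasure (1 : ℝ) 0 p) P)
    (hindep : iIndepFun (fun (e : V × V) ω => A ω e.1 e.2) P) {K : ℕ} (t : Fin K → ℝ) (q : ℝ) :
    ∫ ω, Complex.exp ((traceComb t q (A ω) : ℝ) * Complex.I) ∂P =
      ∫ x, Complex.exp ((traceComb t q (edgeMatrix x) : ℝ) * Complex.I)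
        ∂edgeMeasure (V × V) p := by
  set F : (V × V → ℝ) → ℂ := fun y =>
    Complex.exp ((traceComb t q (Matrix.of fun i j => y (i, j)) : ℝ) * Complex.I) with hF
  have hFc : Continuous F := by
    have h1 : Continuous fun y : V × V → ℝ => (Matrix.of fun i j => y (i, j) : Matrix V V ℝ) :=
      continuous_matrix fun i j => continuous_apply (i, j)
    have h2 := (continuous_traceComb t q).comp h1
    exact Complex.continuous_exp.comp ((Complex.continuous_ofReal.comp h2).mul continuous_const)
  have hA : AEMeasurable (fun ω (e : V × V) => A ω e.1 e.2) P :=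
    aemeasurable_pi_lambda _ fun e => (hlaw e.1 e.2).aemeasurable
  have h1 := integral_map hA (hFc.aestronglyMeasurable (μ := P.map _))
  rw [map_bernoulli_entries hlaw hindep, integral_map Measurable.of_discrete.aemeasurable
    hFc.aestronglyMeasurable] at h1
  exact h1.symm

theorem aemeasurable_trace_pow {V Ω : Type*} [Fintype V] [DecidableEq V] [MeasurableSpace Ω]
    {P : Measure Ω} {A : Ω → Matrix V V ℝ} (hA : ∀ i j, AEMeasurable (fun ω => A ω i j) P) (k : ℕ) :
    AEMeasurable (fun ω => (A ω ^ (k + 1)).trace) P := by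
  simp only [Matrix.trace_pow_succ_eq_sum]
  exact Finset.aemeasurable_fun_sum _ fun w _ => Finset.aemeasurable_fun_prod _ fun i _ => hA _ _

/-- The characteristic function of a vector of independent Gaussian variables. -/
theorem integral_exp_gaussian_vector {Ω : Type*} [MeasurableSpace Ω] {P : Measure Ω}
    [IsProbabilityMeasure P] {ι : Type*} [Fintype ι] {N : ι → Ω → ℝ}
    (hlaw : ∀ k, HasLaw (N k) (gaussianReal 0 1) P) (hindep : iIndepFun N P) (a b t : ι → ℝ) :
    ∫ ω, Complex.exp ((∑ k, t k * (a k * N k ω + b k) : ℝ) * Complex.I) ∂P =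
      Complex.exp ((∑ k, t k * b k : ℝ) * Complex.I) *
        Complex.exp (-((∑ k, (a k * t k) ^ 2) / 2 : ℝ)) := by
  have h1 : ∀ ω, Complex.exp ((∑ k, t k * (a k * N k ω + b k) : ℝ) * Complex.I) =
      Complex.exp ((∑ k, t k * b k : ℝ) * Complex.I) *
        Complex.exp (((∑ k, (fun k ω => t k * a k * N k ω) k ω : ℝ) : ℂ) * Complex.I) := by
    intro ω
    rw [← Complex.exp_add, ← add_mul, ← Complex.ofReal_add, ← Finset.sum_add_distrib]
    congr 3
    exact Finset.sum_congr rfl fun k _ => by ring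
  simp_rw [h1]
  rw [integral_const_mul]
  congr 1
  have hm : ∀ k, AEMeasurable (fun ω => t k * a k * N k ω) P := fun k =>
    (hlaw k).aemeasurable.const_mul _
  have hind : iIndepFun (fun k ω => t k * a k * N k ω) P :=
    hindep.comp (fun k x => t k * a k * x) fun k => measurable_const_mul _
  -- Evaluation at 1 suffices because `t` is absorbed into the variables.
  have h2 := congrFun (hind.charFun_map_fun_sum_eq_prod hm) 1
  rw [charFun_apply_real, integral_map (Finset.aemeasurable_fun_sum _ fun k _ => hm k)
    (by fun_prop)] at h2
  simp only [Complex.ofReal_one, one_mul] at h2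
  rw [h2, Finset.prod_apply]
  have h3 : ∀ k, charFun (P.map fun ω => t k * a k * N k ω) 1 =
      Complex.exp (-((a k * t k) ^ 2 / 2 : ℝ)) := by
    intro k
    rw [charFun_map_mul_comp (hlaw k).aemeasurable, (hlaw k).map_eq, charFun_gaussianReal]
    congr 1
    push_cast
    ring
  simp_rw [h3]
  rw [← Complex.exp_sum]
  congr 1
  push_cast
  rw [Finset.sum_neg_distrib, Finset.sum_div]

theorem charFun_map_toLp_eq_integral {Ω : Type*} [MeasurableSpace Ω] (P : Measure Ω) {ι : Type*}
    [Fintype ι] {X : Ω → ι → ℝ} (hX : AEMeasurable X P) (t : EuclideanSpace ℝ ι) :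
    charFun (P.map fun ω => (WithLp.toLp 2 (X ω) : EuclideanSpace ℝ ι)) t =
      ∫ ω, Complex.exp ((∑ k, t k * X ω k : ℝ) * Complex.I) ∂P := by
  have hm : AEMeasurable (fun ω => (WithLp.toLp 2 (X ω) : EuclideanSpace ℝ ι)) P :=
    (PiLp.continuous_toLp 2 _).measurable.comp_aemeasurable hX
  rw [charFun_apply, integral_map hm (by fun_prop)]
  simp [PiLp.inner_apply]

/-- Lévy's continuity theorem for random vectors, on varying probability spaces. -/
theorem tendstoInDistribution_of_tendsto_integral_exp {Ω : ℕ → Type*} [∀ n, MeasurableSpace (Ω n)]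
    {P : (n : ℕ) → Measure (Ω n)} [∀ n, IsProbabilityMeasure (P n)] {Ω' : Type*}
    [MeasurableSpace Ω'] {P' : Measure Ω'} [IsProbabilityMeasure P'] {ι : Type*} [Fintype ι]
    {X : (n : ℕ) → Ω n → ι → ℝ} {Z : Ω' → ι → ℝ} (hX : ∀ n, AEMeasurable (X n) (P n))
    (hZ : AEMeasurable Z P')
    (h : ∀ t : ι → ℝ, Tendsto
      (fun n => ∫ ω, Complex.exp ((∑ k, t k * X n ω k : ℝ) * Complex.I) ∂P n) atTop
      (𝓝 (∫ ω, Complex.exp ((∑ k, t k * Z ω k : ℝ) * Complex.I) ∂P'))) :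
    TendstoInDistribution X atTop Z P P' := by
  -- Characteristic functions need an inner product, so the vectors pass to `EuclideanSpace`; the
  -- continuous inverse map carries the limit back.
  have hlp : Continuous (WithLp.toLp 2 : (ι → ℝ) → EuclideanSpace ℝ ι) :=
    PiLp.continuous_toLp 2 _
  have hE : TendstoInDistribution
      (fun n ω => (WithLp.toLp 2 (X n ω) : EuclideanSpace ℝ ι)) atTop
      (fun ω => (WithLp.toLp 2 (Z ω) : EuclideanSpace ℝ ι)) P P' := by
    refine ⟨fun n => hlp.measurable.comp_aemeasurable (hX n),
      hlp.measurable.comp_aemeasurable hZ, ?_⟩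
    refine ProbabilityMeasure.tendsto_of_tendsto_charFun fun t => ?_
    have h' := h t
    rw [← charFun_map_toLp_eq_integral P' hZ t] at h'
    exact h'.congr fun n => (charFun_map_toLp_eq_integral (P n) (hX n) t).symm
  exact hE.continuous_comp (g := WithLp.ofLp) (PiLp.continuous_ofLp 2 _)

end Transfer

theorem theorem6
    -- mean degrees `d n`, such that `d n / n` is a Bernoulli parameter (no constraint at `n = 0`)
    (d : ℕ → ℝ) (hd : ∀ n : ℕ, d n / n ∈ unitInterval)
    -- growth hypothesis
    (hd_top : Tendsto d atTop atTop)
    (hd_log : Tendsto (fun n : ℕ => Real.log (d n) / Real.log n) atTop (𝓝 0))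
    -- the random `n × n` matrices `A n`, each on its own probability space
    {Ω : ℕ → Type*} [∀ n, MeasurableSpace (Ω n)]
    (P : (n : ℕ) → Measure (Ω n)) [∀ n, IsProbabilityMeasure (P n)]
    (A : (n : ℕ) → Ω n → Matrix (Fin n) (Fin n) ℝ)
    (hA_law : ∀ (n : ℕ) (i j : Fin n),
      HasLaw (fun ω => A n ω i j) (bernoulliMeasure (1 : ℝ) 0 ⟨d n / n, hd n⟩) (P n))
    (hA_indep : ∀ n : ℕ, iIndepFun (fun (e : Fin n × Fin n) ω => A n ω e.1 e.2) (P n))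
    -- the independent standard Gaussian variables `N k`, `k ≥ 1`
    {Ω' : Type*} [MeasurableSpace Ω'] (P' : Measure Ω') [IsProbabilityMeasure P']
    (N : ℕ+ → Ω' → ℝ)
    (hN_law : ∀ k : ℕ+, HasLaw (N k) (gaussianReal 0 1) P')
    (hN_indep : iIndepFun N P')
    -- the length of the vectors; the coordinate `j : Fin K` corresponds to the power `j + 1`
    (K : ℕ) :
    TendstoInDistribution
      (fun (n : ℕ) (ω : Ω n) (j : Fin K) =>
        (A n ω ^ (j.val + 1)).trace / Real.sqrt (d n) ^ (j.val + 1)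
          - Real.sqrt (d n) ^ (j.val + 1))
      atTop
      (fun (ω : Ω') (j : Fin K) =>
        Real.sqrt ((j.val + 1 : ℕ) : ℝ) * N j.val.succPNat ω
          + if Even (j.val + 1) then 1 else 0)
      P P' := by
  have hX : ∀ n, AEMeasurable (fun (ω : Ω n) (j : Fin K) =>
      (A n ω ^ (j.val + 1)).trace / Real.sqrt (d n) ^ (j.val + 1)
        - Real.sqrt (d n) ^ (j.val + 1)) (P n) := fun n =>
    aemeasurable_pi_lambda _ fun j => ((aemeasurable_trace_pow
      (fun i i' => (hA_law n i i').aemeasurable) j.val).div_const _).sub_const _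
  have hZ : AEMeasurable (fun (ω : Ω') (j : Fin K) =>
      Real.sqrt ((j.val + 1 : ℕ) : ℝ) * N j.val.succPNat ω
        + if Even (j.val + 1) then 1 else 0) P' :=
    aemeasurable_pi_lambda _ fun j => ((hN_law _).aemeasurable.const_mul _).add_const _
  refine tendstoInDistribution_of_tendsto_integral_exp hX hZ fun t => ?_
  have hN := integral_exp_gaussian_vector (N := fun j : Fin K => N j.val.succPNat)
    (fun j => hN_law _) (hN_indep.precomp fun i j hij => Fin.ext (Nat.succPNat_injective hij))
    (fun j => Real.sqrt ((j.val + 1 : ℕ) : ℝ)) (fun j => if Even (j.val + 1) then 1 else 0) t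
  rw [hN]
  have hlim := tendsto_integral_exp_traceComb t hd hd_top hd_log
  simp only [mul_pow, Real.sq_sqrt (Nat.cast_nonneg _)]
  refine hlim.congr fun n => ?_
  exact (integral_exp_traceComb_eq (hA_law n) (hA_indep n) t (Real.sqrt (d n))).symm
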